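/- **Theorem.** Let $n\ge 1$ and let $A=(A_i)_{i\in\mathbb Z}$ be a twisted $n$-gon in the real projective plane, i.e. $A_{i+n}=\phi(A_i)$ for all $i\in\mathbb Z$, for some projective transformation $\phi$. The pentagram map $T$ sends a sequence $A$ indexed by $\mathbb Z$ (respectively $\frac12+\mathbb Z$) to the sequence $B=T(A)$ indexed by $\frac12+\mathbb Z$ (respectively $\mathbb Z$) with $$B_i=\overleftrightarrow{A_{i-\frac32}A_{i+\frac12}}\cap\overleftrightarrow{A_{i-\frac12}A_{i+\frac32}} .$$ With the cross ratio $\chi(a,b,c,d)=\frac{(a-b)(c-d)}{(a-c)(b-d)}$ of four collinear points or of four concurrent lines, Schwartz's coordinates $x_j(A)$ and the parameters $y_j(A)$, $j\in\mathbb Z$, of a sequence $A$ indexed by $\mathbb Z$ or $\frac12+\mathbb Z$ are given, for each index $p$ of $A$, by $$x_{2p}(A)=\chi\big(A_{p-2},A_{p-1},\overleftrightarrow{A_pA_{p+1}}\cap\ell,\overleftrightarrow{A_{p+1}A_{p+2}}\cap\ell\big),\qquad \ell=\overleftrightarrow{A_{p-2}A_{p-1}},$$ $$x_{2p+1}(A)=\chi\big(A_{p+2},A_{p+1},\overleftrightarrow{A_pA_{p-1}}\cap\ell',\overleftrightarrow{A_{p-1}A_{p-2}}\cap\ell'\big),\qquad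 \ell'=\overleftrightarrow{A_{p+2}A_{p+1}},$$ $$y_{2p}(A)=-\Big(\chi\big(\overleftrightarrow{A_pA_{p-2}},\overleftrightarrow{A_pA_{p-1}},\overleftrightarrow{A_pA_{p+1}},\overleftrightarrow{A_pA_{p+2}}\big)\Big)^{-1},$$ $$y_{2p+1}(A)=-\chi\big(\overleftrightarrow{A_{p-2}A_{p-1}}\cap L,A_p,A_{p+1},\overleftrightarrow{A_{p+2}A_{p+3}}\cap L\big),\qquad L=\overleftrightarrow{A_pA_{p+1}}.$$ For $k\in\mathbb Z$ let $Q_k$ be the set of $(r,s,t)\in\mathbb Z^3$ with $2|s|-(k-2)\le t\le k-2-2|r|$ and $2|s|-(k-2)\equiv t\equiv k-2-2|r| \pmod 4$, and let $P_k=Q_{k+1}\cup Q_k$, partially ordered so that $(r',s',t')$ covers $(r,s,t)$ if and only if $t'=t+1$ and $|r'-r|+|s'-s|=1$. Let $J(P_k)$ be the set of order ideals (down-closed subsets) of $P_k$. Let $k\ge 0$, and suppose that for every $0\le i\le k$, among any four consecutive vertices of $T^i(A)$ no three are collinear (so that all these iterates and their $x$- and $y$-coordinates are well defined). Put $x_j=x_j(A)$,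 $y_j=y_j(A)$, $x_{j,k}=x_j(T^k(A))$ and $$F_{j,m}=\sum_{I\in J(P_m)}\ \prod_{(r,s,t)\in I}y_{3r+s+j}\qquad(j,m\in\mathbb Z),$$ so that $F_{j,-1}=F_{j,0}=1$. Then for all $j\in\mathbb Z$ the denominators below are nonzero and $$x_{j,k}=\begin{cases} x_{j-3k}\left(\displaystyle\prod_{i=-k}^{k-1}y_{j+1+3i}\right)\dfrac{F_{j+2,k-1}F_{j-3,k}}{F_{j-2,k-1}F_{j+1,k}}, & j+k\text{ even},\\[3ex] x_{j+3k}\left(\displaystyle\prod_{i=-k}^{k-1}y_{j+1+3i}\right)\dfrac{F_{j-3,k-1}F_{j+2,k}}{F_{j+1,k-1}F_{j-2,k}}, & j+k\text{ odd}. \end{cases}$$ -/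

import Mathlib

namespace PentagramMap

/-- A point of the real projective plane. -/
abbrev Point : Type := Projectivization ℝ (Fin 3 → ℝ)

/-- A line of the real projective plane, in dual homogeneous coordinates: the line `ℓ` consists of
the points `P` with `P.orthogonal ℓ`. -/
abbrev Line : Type := Projectivization ℝ (Fin 3 → ℝ)

/-- The line through two points. It is meaningful for `P ≠ Q`. -/
noncomputable def join (P Q : Point) : Line := Projectivization.cross P Q

/-- The common point of two lines. It is meaningful for `ℓ ≠ m`. -/
noncomputable def meet (ℓ m : Line) : Point := Projectivization.cross ℓ m

/-- The three points lie on a common line. -/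
def Collinear3 (P Q R : Point) : Prop :=
  ∃ ℓ : Line, P.orthogonal ℓ ∧ Q.orthogonal ℓ ∧ R.orthogonal ℓ

/-- Auxiliary bracket: with `n` normal to the plane of two vectors `u`, `v` that represent points
of a line, this is (up to a factor that depends only on the basis chosen in that plane) the
determinant of the coordinates of `u` and `v` in a basis of the plane. -/
noncomputable def bracket (n u v : Projectivization ℝ (Fin 3 → ℝ)) : ℝ :=
  n.rep ⬝ᵥ crossProduct u.rep v.rep

/-- The cross ratio `χ(a,b,c,d) = (a-b)(c-d) / ((a-c)(b-d))` of four elements of a projective line,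
written homogeneously. The same formula serves for four points `a b c d` on the line `n`, and
dually for four lines `a b c d` through the point `n`. It does not depend on the chosen
representatives, and is meaningful (a finite number) for `a ≠ c` and `b ≠ d`. -/
noncomputable def crossRatio (n a b c d : Projectivization ℝ (Fin 3 → ℝ)) : ℝ :=
  (bracket n a b * bracket n c d) / (bracket n a c * bracket n b d)

/-- A bi-infinite sequence of points indexed by `shift / 2 + ℤ`: the vertex whose index is
`i + shift / 2` is `pt i`. Thus it is indexed by `ℤ` when `shift` is even and by `1/2 + ℤ` when
`shift` is odd. -/
structure Polygon where
  shift : ℤ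
  pt : ℤ → Point

namespace Polygon

/-- `A` is a twisted `n`-gon: `A_{i+n} = φ(A_i)` for all `i`, for some projective
transformation `φ`. -/
def IsTwisted (n : ℕ) (A : Polygon) : Prop :=
  ∃ φ : (Fin 3 → ℝ) ≃ₗ[ℝ] (Fin 3 → ℝ), ∀ i : ℤ,
    A.pt (i + n) = Projectivization.map φ.toLinearMap φ.injective (A.pt i)

/-- The pentagram map `B = T(A)`, where for each index `p` of `B`
`B_p = A_{p-3/2}A_{p+1/2} ∩ A_{p-1/2}A_{p+3/2}`.
With `p = i + (shift + 1) / 2`, the four vertices of `A` involved are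
`pt (i-1)`, `pt (i+1)`, `pt i`, `pt (i+2)`. -/
noncomputable def pentagram (A : Polygon) : Polygon where
  shift := A.shift + 1
  pt i := meet (join (A.pt (i - 1)) (A.pt (i + 1))) (join (A.pt i) (A.pt (i + 2)))

/-- Among any four consecutive vertices no three are collinear. For a polygon this says exactly
that all its `x`-coordinates and `y`-parameters below are well-defined real numbers. -/
def IsGeneric (A : Polygon) : Prop :=
  ∀ i : ℤ,
    ¬ Collinear3 (A.pt i) (A.pt (i + 1)) (A.pt (i + 2)) ∧
    ¬ Collinear3 (A.pt i) (A.pt (i + 1)) (A.pt (i + 3)) ∧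
    ¬ Collinear3 (A.pt i) (A.pt (i + 2)) (A.pt (i + 3)) ∧
    ¬ Collinear3 (A.pt (i + 1)) (A.pt (i + 2)) (A.pt (i + 3))

/-- The coordinate `x_{2p}`, where `p` is the index of the vertex `pt i`. -/
noncomputable def xEven (A : Polygon) (i : ℤ) : ℝ :=
  let ℓ := join (A.pt (i - 2)) (A.pt (i - 1))
  crossRatio ℓ (A.pt (i - 2)) (A.pt (i - 1))
    (meet (join (A.pt i) (A.pt (i + 1))) ℓ)
    (meet (join (A.pt (i + 1)) (A.pt (i + 2))) ℓ)

/-- The coordinate `x_{2p+1}`, where `p` is the index of the vertex `pt i`. -/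
noncomputable def xOdd (A : Polygon) (i : ℤ) : ℝ :=
  let ℓ := join (A.pt (i + 2)) (A.pt (i + 1))
  crossRatio ℓ (A.pt (i + 2)) (A.pt (i + 1))
    (meet (join (A.pt i) (A.pt (i - 1))) ℓ)
    (meet (join (A.pt (i - 1)) (A.pt (i - 2))) ℓ)

/-- Schwartz's coordinate `x_j(A)`, `j ∈ ℤ`. If `j / 2` is an index `p` of `A`, the vertex `A_p` is
`pt ((j - shift) / 2)`; otherwise `j = 2p + 1` with `p` an index of `A`, and `A_p` is
`pt ((j - 1 - shift) / 2)`. -/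
noncomputable def x (A : Polygon) (j : ℤ) : ℝ :=
  if Even (j - A.shift) then A.xEven ((j - A.shift) / 2) else A.xOdd ((j - 1 - A.shift) / 2)

/-- The parameter `y_{2p}`, where `p` is the index of the vertex `pt i`. -/
noncomputable def yVertex (A : Polygon) (i : ℤ) : ℝ :=
  -(crossRatio (A.pt i) (join (A.pt i) (A.pt (i - 2))) (join (A.pt i) (A.pt (i - 1)))
    (join (A.pt i) (A.pt (i + 1))) (join (A.pt i) (A.pt (i + 2))))⁻¹

/-- The parameter `y_{2p+1}`, where `p` is the index of the vertex `pt i`. -/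
noncomputable def yEdge (A : Polygon) (i : ℤ) : ℝ :=
  -(let L := join (A.pt i) (A.pt (i + 1))
    crossRatio L (meet (join (A.pt (i - 2)) (A.pt (i - 1))) L) (A.pt i) (A.pt (i + 1))
      (meet (join (A.pt (i + 2)) (A.pt (i + 3))) L))

/-- The `y`-parameter `y_j(A)`, `j ∈ ℤ`, with the same indexing as for `x`. -/
noncomputable def y (A : Polygon) (j : ℤ) : ℝ :=
  if Even (j - A.shift) then A.yVertex ((j - A.shift) / 2) else A.yEdge ((j - 1 - A.shift) / 2)

end Polygon

/-- Membership of a triple `(r,s,t)` in the set `Q_k`. -/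
def InQ (k : ℤ) (p : ℤ × ℤ × ℤ) : Prop :=
  (2 * |p.2.1| - (k - 2) ≤ p.2.2 ∧ p.2.2 ≤ k - 2 - 2 * |p.1|) ∧
  (2 * |p.2.1| - (k - 2) ≡ p.2.2 [ZMOD 4] ∧ p.2.2 ≡ k - 2 - 2 * |p.1| [ZMOD 4])

open Classical in
/-- The set `P_k = Q_{k+1} ∪ Q_k`, which is finite; see `mem_posetP`. -/
noncomputable def posetP (k : ℤ) : Finset (ℤ × ℤ × ℤ) :=
  {p ∈ Finset.Icc (-k) k ×ˢ Finset.Icc (-k) k ×ˢ Finset.Icc (-k) k | InQ (k + 1) p ∨ InQ k p}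

theorem mem_posetP (k : ℤ) (p : ℤ × ℤ × ℤ) : p ∈ posetP k ↔ InQ (k + 1) p ∨ InQ k p := by
  obtain ⟨r, s, t⟩ := p
  simp only [posetP, Finset.mem_filter, Finset.mem_product, Finset.mem_Icc, and_iff_right_iff_imp]
  have h1 := neg_abs_le r
  have h2 := le_abs_self r
  have h3 := neg_abs_le s
  have h4 := le_abs_self s
  have h5 := abs_nonneg r
  have h6 := abs_nonneg s
  rintro (⟨⟨h, h'⟩, -⟩ | ⟨⟨h, h'⟩, -⟩) <;> simp only at h h' <;> omega

/-- `Covers q p`: the triple `q = (r',s',t')` covers `p = (r,s,t)`. -/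
def Covers (q p : ℤ × ℤ × ℤ) : Prop :=
  q.2.2 = p.2.2 + 1 ∧ |q.1 - p.1| + |q.2.1 - p.2.1| = 1

/-- The strict order `p < q` of `P_k`, generated by the covering relation on `P_k`. -/
def PosetLT (k : ℤ) : ℤ × ℤ × ℤ → ℤ × ℤ × ℤ → Prop :=
  Relation.TransGen fun p q => p ∈ posetP k ∧ q ∈ posetP k ∧ Covers q p

open Classical in
/-- The set `J(P_k)` of order ideals of `P_k`. -/
noncomputable def orderIdeals (k : ℤ) : Finset (Finset (ℤ × ℤ × ℤ)) :=
  {I ∈ (posetP k).powerset | ∀ p ∈ I, ∀ q ∈ posetP k, PosetLT k q p → q ∈ I}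

/-- The `F`-polynomial `F_{j,k} = ∑_{I ∈ J(P_k)} ∏_{(r,s,t) ∈ I} y_{3r+s+j}`, evaluated at `y`.
For `k ≤ 0` the set `P_k` is empty and the value is `1`. -/
noncomputable def F {R : Type*} [CommSemiring R] (y : ℤ → R) (j k : ℤ) : R :=
  ∑ I ∈ orderIdeals k, ∏ p ∈ I, y (3 * p.1 + p.2.1 + j)

end PentagramMap

/-!
The proof is by induction on the number `k` of iterations, applying the induction hypothesis to the
polygon `T(A)` instead of `A`. This requires expressing everything about `T(A)` through `A`.

*Geometry.* In homogeneous coordinates each `x_j` and `y_j` is a quotient of products of `3 × 3`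
determinants of vertices (`GenericLift.xEven_eq` and its companions). The vertices of `T(A)` are
cross products of cross products, and the determinants of consecutive ones factor into determinants
of vertices of `A`. As `1 + y_j` also factors when `j / 2` is the index of a vertex, by the
quadratic relation between determinants, this gives the `x`-coordinates of `T(A)`
(`GenericLift.xEven_pentagram`, `GenericLift.xOdd_pentagram`), and, because `y_j` is
`-(x_j x_{j+1})^{±1}`, also its `y`-parameters: one half of the `y_j` are inverted, and the others
are multiplied by factors `1 + y_{j ± 1}` and `(1 + 1 / y_{j ± 3})⁻¹`. Genericity of `T(A)` is what
makes the factors `1 + y_j` that occur here nonzero.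

*Combinatorics.* The posets `P_{k+1}` and `P_k` share the layer `Q_{k+1}`; the former has in addition
`Q_{k+2}`, the latter `Q_k`. In the generating function of order ideals the additional layer can be
summed out: once the trace `A` of an ideal on `Q_{k+1}` is fixed, the elements of the other layer are
forced in, forced out, or free, independently of each other. Comparing the results, the sum over
ideals of `P_{k+1}` is an explicit product times the sum over ideals of `P_k` with mutated weights
(`sum_orderIdeals_succ_eq_mutate`). The mutation is exactly the change of the `y`-parameters under
`T`, so that `F_{j,k+1}` of `A` is a product of factors `1 + y_i` times `F_{j,k}` of `T(A)`
(`Polygon.IsGeneric.F_eq_F_pentagram`). In particular it is nonzero if the latter is.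

Substituting all this into the formula for `T(A)` and `k`, the products of factors `1 + y_i`
telescope and the formula for `A` and `k + 1` is left.
-/

namespace PentagramMap

/-! ### Order ideals of a poset with two layers -/

open Classical in
/-- The elements of `T` that a down-closed set with trace `A` on `S` must contain: those lying
directly below an element of `A`. -/
noncomputable def lowerPart {α : Type*} (cov : α → α → Prop) (T A : Finset α) : Finset α :=
  {q ∈ T | ∃ p ∈ A, cov p q}

open Classical in
/-- The elements of `T` that a down-closed set with trace `A` on `S` may contain: those all of
whose lower neighbours in `S` belong to `A`. -/
noncomputable def upperPart {α : Type*} (cov : α → α → Prop) (S T A : Finset α) : Finset α :=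
  {q ∈ T | ∀ p ∈ S, cov q p → p ∈ A}

theorem mem_lowerPart {α : Type*} {cov : α → α → Prop} {T A : Finset α} {q : α} :
    q ∈ lowerPart cov T A ↔ q ∈ T ∧ ∃ p ∈ A, cov p q := by
  simp only [lowerPart, Finset.mem_filter]

theorem mem_upperPart {α : Type*} {cov : α → α → Prop} {S T A : Finset α} {q : α} :
    q ∈ upperPart cov S T A ↔ q ∈ T ∧ ∀ p ∈ S, cov q p → p ∈ A := by
  simp only [upperPart, Finset.mem_filter]

theorem lowerPart_subset {α : Type*} (cov : α → α → Prop) (T A : Finset α) :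
    lowerPart cov T A ⊆ T := by
  classical exact Finset.filter_subset _ _

theorem upperPart_subset {α : Type*} (cov : α → α → Prop) (S T A : Finset α) :
    upperPart cov S T A ⊆ T := by
  classical exact Finset.filter_subset _ _

section TwoLayers

variable {α R : Type*} [DecidableEq α] [CommRing R]

theorem sum_Icc_prod (L U : Finset α) (w : α → R) :
    ∑ B ∈ Finset.Icc L U, ∏ q ∈ B, w q =
      if L ⊆ U then (∏ q ∈ L, w q) * ∏ q ∈ U \ L, (1 + w q) else 0 := by
  split_ifs with h
  · rw [Finset.Icc_eq_image_powerset h, Finset.sum_image, Finset.prod_one_add, Finset.mul_sum]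
    · refine Finset.sum_congr rfl fun B hB => Finset.prod_union ?_
      exact (Finset.disjoint_sdiff.mono_right (Finset.mem_powerset.1 hB))
    · intro B hB B' hB' e
      have hd : ∀ C ∈ (U \ L).powerset, (L ∪ C) \ L = C := fun C hC =>
        Finset.union_sdiff_cancel_left
          (Finset.disjoint_sdiff.mono_right (Finset.mem_powerset.1 hC))
      rw [← hd B hB, ← hd B' hB']
      exact congrArg (· \ L) e
  · rw [Finset.Icc_eq_empty (by simpa using h), Finset.sum_empty]

open Classical in
/-- The generating function of the down-closed subsets of `S ∪ T`, when the covering relation only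
relates elements of different layers. Once the trace `A` on `S` is chosen, the elements of `T` are
forced in, forced out, or free, independently of each other. -/
theorem sum_downClosed_eq (cov : α → α → Prop) (S T : Finset α) (hST : Disjoint S T)
    (hS : ∀ p ∈ S, ∀ q ∈ S, ¬ cov p q) (hT : ∀ p ∈ T, ∀ q ∈ T, ¬ cov p q) (w : α → R) :
    ∑ I ∈ (S ∪ T).powerset with ∀ p ∈ I, ∀ q ∈ S ∪ T, cov p q → q ∈ I, ∏ p ∈ I, w p =
      ∑ A ∈ S.powerset, (∏ p ∈ A, w p) *
        if lowerPart cov T A ⊆ upperPart cov S T A then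
          (∏ q ∈ lowerPart cov T A, w q) *
            ∏ q ∈ upperPart cov S T A \ lowerPart cov T A, (1 + w q)
        else 0 := by
  simp_rw [← sum_Icc_prod, Finset.mul_sum]
  rw [Finset.sum_sigma']
  have hd : ∀ {p}, p ∈ S → p ∉ T := fun hp hq => Finset.disjoint_left.1 hST hp hq
  refine Finset.sum_bij' (fun I _ => ⟨I ∩ S, I ∩ T⟩) (fun X _ => X.1 ∪ X.2) ?_ ?_ ?_ ?_ ?_
  · intro I hI
    simp only [Finset.mem_filter, Finset.mem_powerset] at hI
    simp only [Finset.mem_sigma, Finset.mem_powerset, Finset.mem_Icc]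
    refine ⟨Finset.inter_subset_right, fun q hq => ?_, fun q hq => ?_⟩
    · simp only [mem_lowerPart, Finset.mem_inter] at hq ⊢
      obtain ⟨hqT, p, hp, hc⟩ := hq
      exact ⟨hI.2 p hp.1 q (Finset.mem_union_right _ hqT) hc, hqT⟩
    · simp only [mem_upperPart, Finset.mem_inter] at hq ⊢
      exact ⟨hq.2, fun p hp hc => ⟨hI.2 q hq.1 p (Finset.mem_union_left _ hp) hc, hp⟩⟩
  · rintro ⟨A, B⟩ hX
    simp only [Finset.mem_sigma, Finset.mem_powerset, Finset.mem_Icc] at hX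
    obtain ⟨hA, hL, hU⟩ := hX
    have hBT : B ⊆ T := fun q hq => (mem_upperPart.1 (hU hq)).1
    simp only [Finset.mem_filter, Finset.mem_powerset]
    refine ⟨Finset.union_subset_union hA hBT, fun p hp q hq hc => ?_⟩
    rw [Finset.mem_union] at hp hq ⊢
    rcases hp with hp | hp <;> rcases hq with hq | hq
    · exact absurd hc (hS p (hA hp) q hq)
    · exact Or.inr (hL (mem_lowerPart.2 ⟨hq, p, hp, hc⟩))
    · exact Or.inl ((mem_upperPart.1 (hU hp)).2 q hq hc)
    · exact absurd hc (hT p (hBT hp) q hq)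
  · intro I hI
    simp only [Finset.mem_filter, Finset.mem_powerset] at hI
    simp only [← Finset.inter_union_distrib_left, Finset.inter_eq_left.2 hI.1]
  · rintro ⟨A, B⟩ hX
    simp only [Finset.mem_sigma, Finset.mem_powerset, Finset.mem_Icc] at hX
    obtain ⟨hA, hL, hU⟩ := hX
    have hBT : B ⊆ T := fun q hq => (mem_upperPart.1 (hU hq)).1
    have h1 : (A ∪ B) ∩ S = A := by
      ext p; simp only [Finset.mem_inter, Finset.mem_union]
      exact ⟨fun h => h.1.resolve_right fun hb => hd h.2 (hBT hb), fun h => ⟨Or.inl h, hA h⟩⟩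
    have h2 : (A ∪ B) ∩ T = B := by
      ext p; simp only [Finset.mem_inter, Finset.mem_union]
      exact ⟨fun h => h.1.resolve_left fun ha => hd (hA ha) h.2, fun h => ⟨Or.inr h, hBT h⟩⟩
    simp only [h1, h2]
  · intro I hI
    simp only [Finset.mem_filter, Finset.mem_powerset] at hI
    rw [← Finset.prod_union (hST.mono Finset.inter_subset_right Finset.inter_subset_right),
      ← Finset.inter_union_distrib_left, Finset.inter_eq_left.2 hI.1]

end TwoLayers

/-! ### The layers of the posets `P_k` -/

theorem two_mul_abs_emod_four (a : ℤ) : (2 * |a|) % 4 = (2 * a) % 4 := by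
  rcases abs_cases a with ⟨h, -⟩ | ⟨h, -⟩
  · rw [h]
  · rw [h]
    omega

/-- Membership in `Q_k` in terms of linear inequalities and congruences. -/
theorem inQ_iff (k r s t : ℤ) :
    InQ k (r, s, t) ↔ (2 * s - (k - 2) ≤ t ∧ -(2 * s) - (k - 2) ≤ t ∧
      t ≤ k - 2 - 2 * r ∧ t ≤ k - 2 + 2 * r) ∧
      (t + 2 * r - k + 2) % 4 = 0 ∧ (t + 2 * s + k - 2) % 4 = 0 := by
  have hr := two_mul_abs_emod_four r
  have hs := two_mul_abs_emod_four s
  have h1 : |r| = max r (-r) := rfl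
  have h2 : |s| = max s (-s) := rfl
  simp only [InQ, Int.ModEq]
  omega

open Classical in
/-- The set `Q_k`, as a finite set. -/
noncomputable def layer (k : ℤ) : Finset (ℤ × ℤ × ℤ) := {p ∈ posetP k | InQ k p}

theorem mem_layer {k : ℤ} {p : ℤ × ℤ × ℤ} : p ∈ layer k ↔ InQ k p := by
  simp only [layer, Finset.mem_filter, mem_posetP]
  tauto

theorem mem_layer_iff {k r s t : ℤ} :
    (r, s, t) ∈ layer k ↔ (2 * s - (k - 2) ≤ t ∧ -(2 * s) - (k - 2) ≤ t ∧
      t ≤ k - 2 - 2 * r ∧ t ≤ k - 2 + 2 * r) ∧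
      (t + 2 * r - k + 2) % 4 = 0 ∧ (t + 2 * s + k - 2) % 4 = 0 := by
  rw [mem_layer, inQ_iff]

theorem posetP_eq_union (k : ℤ) : posetP k = layer (k + 1) ∪ layer k := by
  ext p
  rw [Finset.mem_union, mem_layer, mem_layer, mem_posetP]

theorem disjoint_layer {k l : ℤ} (h : (l - k) % 2 = 1) : Disjoint (layer k) (layer l) := by
  rw [Finset.disjoint_left]
  rintro ⟨r, s, t⟩ h1 h2
  rw [mem_layer_iff] at h1 h2
  omega

theorem not_covers_of_mem_layer {k : ℤ} {p q : ℤ × ℤ × ℤ} (hp : p ∈ layer k) (hq : q ∈ layer k) :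
    ¬ Covers p q := by
  obtain ⟨r, s, t⟩ := p
  obtain ⟨r', s', t'⟩ := q
  rw [mem_layer_iff] at hp hq
  rintro ⟨h, -⟩
  dsimp only at h
  omega

theorem covers_iff (r s t r' s' t' : ℤ) : Covers (r', s', t') (r, s, t) ↔ t' = t + 1 ∧
    ((r' = r + 1 ∧ s' = s) ∨ (r' = r - 1 ∧ s' = s) ∨
      (r' = r ∧ s' = s + 1) ∨ (r' = r ∧ s' = s - 1)) := by
  have h1 : |r' - r| = max (r' - r) (-(r' - r)) := rfl
  have h2 : |s' - s| = max (s' - s) (-(s' - s)) := rfl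
  simp only [Covers]
  omega

open Classical in
/-- It suffices to test down-closedness on covering pairs. -/
theorem orderIdeals_eq_filter_covers (k : ℤ) :
    orderIdeals k = {I ∈ (posetP k).powerset | ∀ p ∈ I, ∀ q ∈ posetP k, Covers p q → q ∈ I} := by
  ext I
  simp only [orderIdeals, Finset.mem_filter, Finset.mem_powerset]
  refine and_congr_right fun hI => ⟨fun h p hp q hq hc => ?_, fun h p hp q _ hlt => ?_⟩
  · exact h p hp q hq (Relation.TransGen.single ⟨hq, hI hp, hc⟩)
  · induction hlt using Relation.TransGen.head_induction_on with
    | single h' => exact h p hp _ h'.1 h'.2.2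
    | head h' _ ih => exact h _ (ih h'.2.1) _ h'.1 h'.2.2

/-! ### The generating function of order ideals under mutation of the weights -/

open Classical in
/-- Order ideals of the union of two adjacent layers, grouped by their trace on the layer `S`. -/
theorem sum_orderIdeals_eq {R : Type*} [CommRing R] {k a b : ℤ}
    (h : (a = k + 1 ∧ b = k) ∨ (a = k ∧ b = k + 1)) (w : ℤ × ℤ × ℤ → R) :
    ∑ I ∈ orderIdeals k, ∏ p ∈ I, w p = ∑ A ∈ (layer a).powerset, (∏ p ∈ A, w p) *
      if lowerPart Covers (layer b) A ⊆ upperPart Covers (layer a) (layer b) A then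
        (∏ q ∈ lowerPart Covers (layer b) A, w q) *
          ∏ q ∈ upperPart Covers (layer a) (layer b) A \ lowerPart Covers (layer b) A, (1 + w q)
      else 0 := by
  rw [← sum_downClosed_eq Covers (layer a) (layer b) (disjoint_layer (by omega))
    (fun p hp q hq => not_covers_of_mem_layer hp hq)
    (fun p hp q hq => not_covers_of_mem_layer hp hq), orderIdeals_eq_filter_covers]
  have : posetP k = layer a ∪ layer b := by
    rw [posetP_eq_union]
    rcases h with ⟨rfl, rfl⟩ | ⟨rfl, rfl⟩
    · rfl
    · exact Finset.union_comm _ _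
  rw [this]

section Layers

variable {k : ℤ} {A : Finset (ℤ × ℤ × ℤ)}

theorem mem_lowerPart_succ (hA : A ⊆ layer (k + 1)) (r s t : ℤ) :
    (r, s, t) ∈ lowerPart Covers (layer (k + 2)) A ↔
      (r - 1, s, t + 1) ∈ A ∨ (r + 1, s, t + 1) ∈ A := by
  simp only [mem_lowerPart, Prod.exists, covers_iff]
  constructor
  · rintro ⟨hq, r', s', t', hp, rfl, ⟨rfl, rfl⟩ | ⟨rfl, rfl⟩ | ⟨rfl, rfl⟩ | ⟨rfl, rfl⟩⟩
    · exact Or.inr hp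
    · exact Or.inl hp
    all_goals
      have := hA hp
      rw [mem_layer_iff] at this hq
      omega
  · rintro (hp | hp)
    · refine ⟨?_, _, _, _, hp, rfl, by omega⟩
      have := hA hp
      rw [mem_layer_iff] at this ⊢
      omega
    · refine ⟨?_, _, _, _, hp, rfl, by omega⟩
      have := hA hp
      rw [mem_layer_iff] at this ⊢
      omega

theorem mem_upperPart_pred (hA : A ⊆ layer (k + 1)) (r s t : ℤ) :
    (r, s, t) ∈ upperPart Covers (layer (k + 1)) (layer k) A ↔
      (r - 1, s, t - 1) ∈ A ∧ (r + 1, s, t - 1) ∈ A := by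
  simp only [mem_upperPart, Prod.forall, covers_iff]
  constructor
  · rintro ⟨hq, h⟩
    rw [mem_layer_iff] at hq
    exact ⟨h _ _ _ (by rw [mem_layer_iff]; omega) (by omega),
      h _ _ _ (by rw [mem_layer_iff]; omega) (by omega)⟩
  · rintro ⟨h1, h2⟩
    have h1' := hA h1
    have h2' := hA h2
    rw [mem_layer_iff] at h1' h2'
    refine ⟨by rw [mem_layer_iff]; omega, fun r' s' t' hp hc => ?_⟩
    rw [mem_layer_iff] at hp
    obtain ⟨ht, hc | hc | hc | hc⟩ := hc
    · convert h1 using 3 <;> omega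
    · convert h2 using 3 <;> omega
    all_goals omega

theorem mem_compl_upperPart_succ (r s t : ℤ) :
    (r, s, t) ∈ layer (k + 2) \ upperPart Covers (layer (k + 1)) (layer (k + 2)) A ↔
      (r, s - 1, t - 1) ∈ layer (k + 1) \ A ∨ (r, s + 1, t - 1) ∈ layer (k + 1) \ A := by
  simp only [mem_upperPart, Finset.mem_sdiff, Prod.forall, covers_iff, not_and,
    not_forall]
  constructor
  · rintro ⟨hq, h⟩
    obtain ⟨r', s', t', hp, ⟨ht, hc⟩, hn⟩ := h hq
    obtain rfl : t' = t - 1 := by omega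
    rcases hc with ⟨hr, hs⟩ | ⟨hr, hs⟩ | ⟨hr, hs⟩ | ⟨hr, hs⟩
    · rw [mem_layer_iff] at hp hq
      omega
    · rw [mem_layer_iff] at hp hq
      omega
    · obtain rfl : s' = s - 1 := by omega
      subst hr
      exact Or.inl ⟨hp, hn⟩
    · obtain rfl : s' = s + 1 := by omega
      subst hr
      exact Or.inr ⟨hp, hn⟩
  · rintro (⟨hp, hn⟩ | ⟨hp, hn⟩)
    · refine ⟨?_, fun _ => ⟨_, _, _, hp, by omega, hn⟩⟩
      rw [mem_layer_iff] at hp ⊢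
      omega
    · refine ⟨?_, fun _ => ⟨_, _, _, hp, by omega, hn⟩⟩
      rw [mem_layer_iff] at hp ⊢
      omega

theorem mem_compl_lowerPart_pred (hA : A ⊆ layer (k + 1)) (r s t : ℤ) :
    (r, s, t) ∈ layer k \ lowerPart Covers (layer k) A ↔
      (r, s - 1, t + 1) ∈ layer (k + 1) \ A ∧ (r, s + 1, t + 1) ∈ layer (k + 1) \ A := by
  simp only [mem_lowerPart, Finset.mem_sdiff, Prod.exists, covers_iff, not_and,
    not_exists]
  constructor
  · rintro ⟨hq, h⟩
    refine ⟨⟨?_, fun hp => h hq _ _ _ hp (by omega) (by omega)⟩,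
      ⟨?_, fun hp => h hq _ _ _ hp (by omega) (by omega)⟩⟩
    · rw [mem_layer_iff] at hq ⊢
      omega
    · rw [mem_layer_iff] at hq ⊢
      omega
  · rintro ⟨⟨h1, h1'⟩, h2, h2'⟩
    refine ⟨by rw [mem_layer_iff] at h1 h2 ⊢; omega, fun hq r' s' t' hp ht hc => ?_⟩
    have hp' := hA hp
    rw [mem_layer_iff] at hp' hq
    rcases hc with ⟨hr, hs⟩ | ⟨hr, hs⟩ | ⟨hr, hs⟩ | ⟨hr, hs⟩
    · omega
    · omega
    · subst hr hs ht
      exact h2' hp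
    · subst hr hs ht
      exact h1' hp

theorem lowerPart_succ_subset_iff (hA : A ⊆ layer (k + 1)) :
    lowerPart Covers (layer (k + 2)) A ⊆ upperPart Covers (layer (k + 1)) (layer (k + 2)) A ↔
      ∀ r s t, ((r - 1, s, t + 1) ∈ A ∨ (r + 1, s, t + 1) ∈ A) →
        ((r, s - 1, t - 1) ∈ layer (k + 1) → (r, s - 1, t - 1) ∈ A) ∧
        ((r, s + 1, t - 1) ∈ layer (k + 1) → (r, s + 1, t - 1) ∈ A) := by
  simp only [Finset.subset_iff, Prod.forall, mem_lowerPart_succ hA]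
  refine forall_congr' fun r => forall_congr' fun s => forall_congr' fun t =>
    imp_congr_right fun h => ?_
  have hq := lowerPart_subset _ _ _ ((mem_lowerPart_succ hA r s t).2 h)
  have := mem_compl_upperPart_succ (k := k) (A := A) r s t
  simp only [Finset.mem_sdiff, hq, true_and] at this
  rw [← not_iff_not, this, not_and_or, Classical.not_imp, Classical.not_imp]

theorem lowerPart_pred_subset_iff (hA : A ⊆ layer (k + 1)) :
    lowerPart Covers (layer k) A ⊆ upperPart Covers (layer (k + 1)) (layer k) A ↔
      ∀ r s t, (r, s, t) ∈ layer k → ((r, s - 1, t + 1) ∈ A ∨ (r, s + 1, t + 1) ∈ A) →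
        (r - 1, s, t - 1) ∈ A ∧ (r + 1, s, t - 1) ∈ A := by
  simp only [Finset.subset_iff, Prod.forall, mem_upperPart_pred hA]
  refine forall_congr' fun r => forall_congr' fun s => forall_congr' fun t => ?_
  have h1 := mem_compl_lowerPart_pred hA r s t
  by_cases hq : (r, s, t) ∈ layer k
  · have h3 : (r, s - 1, t + 1) ∈ layer (k + 1) ∧ (r, s + 1, t + 1) ∈ layer (k + 1) := by
      rw [mem_layer_iff] at hq
      simp only [mem_layer_iff]
      omega
    simp only [Finset.mem_sdiff, hq, h3.1, h3.2, true_and] at h1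
    rw [not_iff_comm, not_and_or, not_not, not_not] at h1
    simp only [hq, true_imp_iff, ← h1]
  · simp only [hq, false_imp_iff, iff_true]
    exact fun h => absurd (lowerPart_subset _ _ _ h) hq

/-- A trace `A` on `Q_{k+1}` extends to an order ideal of `Q_{k+2} ∪ Q_{k+1}` if and only if it
extends to one of `Q_{k+1} ∪ Q_k`: either condition says that `A` is closed under the moves
`(r, s, t) ↦ (r ± 1, s ± 1, t - 2)` that stay in `Q_{k+1}`. -/
theorem lowerPart_subset_upperPart_iff (hA : A ⊆ layer (k + 1)) :
    lowerPart Covers (layer (k + 2)) A ⊆ upperPart Covers (layer (k + 1)) (layer (k + 2)) A ↔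
      lowerPart Covers (layer k) A ⊆ upperPart Covers (layer (k + 1)) (layer k) A := by
  rw [lowerPart_succ_subset_iff hA, lowerPart_pred_subset_iff hA]
  constructor
  · intro h r s t hq hp
    rw [mem_layer_iff] at hq
    have ha : (r - 1, s, t - 1) ∈ layer (k + 1) := by rw [mem_layer_iff]; omega
    have hb : (r + 1, s, t - 1) ∈ layer (k + 1) := by rw [mem_layer_iff]; omega
    rcases hp with hp | hp
    · have h1 := (h (r - 1) (s - 1) t (Or.inr (by simpa using hp))).2
      have h2 := (h (r + 1) (s - 1) t (Or.inl (by simpa using hp))).2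
      simp only [sub_add_cancel] at h1 h2
      exact ⟨h1 ha, h2 hb⟩
    · have h1 := (h (r - 1) (s + 1) t (Or.inr (by simpa using hp))).1
      have h2 := (h (r + 1) (s + 1) t (Or.inl (by simpa using hp))).1
      simp only [add_sub_cancel_right] at h1 h2
      exact ⟨h1 ha, h2 hb⟩
  · intro h r s t hp
    rcases hp with hp | hp
    · have hp' := hA hp
      rw [mem_layer_iff] at hp'
      constructor <;> intro hm <;> rw [mem_layer_iff] at hm
      · have := (h (r - 1) (s - 1) t (by rw [mem_layer_iff]; omega) (Or.inr (by simpa using hp))).2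
        simpa using this
      · have := (h (r - 1) (s + 1) t (by rw [mem_layer_iff]; omega) (Or.inl (by simpa using hp))).2
        simpa using this
    · have hp' := hA hp
      rw [mem_layer_iff] at hp'
      constructor <;> intro hm <;> rw [mem_layer_iff] at hm
      · have := (h (r + 1) (s - 1) t (by rw [mem_layer_iff]; omega) (Or.inr (by simpa using hp))).1
        simpa using this
      · have := (h (r + 1) (s + 1) t (by rw [mem_layer_iff]; omega) (Or.inl (by simpa using hp))).1
        simpa using this

/-- The projections of `X` and `Y` to the plane, taken together, are the two translates of the
projection of `A`: an or and an and of two conditions count as many as the conditions themselves. -/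
theorem prod_mul_prod_of_or_of_and {R : Type*} [CommMonoid R] (a b c : ℤ)
    {X Y A : Finset (ℤ × ℤ × ℤ)}
    (hX : ∀ r s t, (r, s, t) ∈ X ↔ (r - a, s - b, t - c) ∈ A ∨ (r + a, s + b, t - c) ∈ A)
    (hY : ∀ r s t, (r, s, t) ∈ Y ↔ (r - a, s - b, t + c) ∈ A ∧ (r + a, s + b, t + c) ∈ A)
    (g : ℤ → ℤ → R) :
    (∏ q ∈ X, g q.1 q.2.1) * ∏ q ∈ Y, g q.1 q.2.1 =
      ∏ p ∈ A, (g (p.1 + a) (p.2.1 + b) * g (p.1 - a) (p.2.1 - b)) := by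
  have mem_map : ∀ u v w r s t : ℤ,
      (r, s, t) ∈ A.map (addRightEmbedding (u, v, w)) ↔ (r - u, s - v, t - w) ∈ A := by
    intro u v w r s t
    simp only [Finset.mem_map, addRightEmbedding_apply, Prod.exists, Prod.mk_add_mk, Prod.mk.injEq]
    constructor
    · rintro ⟨r', s', t', h, rfl, rfl, rfl⟩
      simpa using h
    · exact fun h => ⟨_, _, _, h, by omega, by omega, by omega⟩
  have hX' : X = A.map (addRightEmbedding (a, b, c)) ∪ A.map (addRightEmbedding (-a, -b, c)) := by
    ext ⟨r, s, t⟩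
    simp only [hX, Finset.mem_union, mem_map, sub_neg_eq_add]
  have hY' : ∏ q ∈ Y, g q.1 q.2.1 = ∏ q ∈ A.map (addRightEmbedding (a, b, c)) ∩
      A.map (addRightEmbedding (-a, -b, c)), g q.1 q.2.1 := by
    refine Finset.prod_bij' (fun q _ => (q.1, q.2.1, q.2.2 + 2 * c))
      (fun q _ => (q.1, q.2.1, q.2.2 - 2 * c)) ?_ ?_ ?_ ?_ ?_
    · rintro ⟨r, s, t⟩ h
      simp only [Finset.mem_inter, mem_map, sub_neg_eq_add]
      rwa [hY, show t + c = t + 2 * c - c by ring] at h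
    · rintro ⟨r, s, t⟩ h
      simp only [Finset.mem_inter, mem_map, sub_neg_eq_add] at h
      rwa [hY, show t - 2 * c + c = t - c by ring]
    · simp
    · simp
    · simp
  rw [hX', hY', Finset.prod_union_inter, Finset.prod_map, Finset.prod_map,
    ← Finset.prod_mul_distrib]
  refine Finset.prod_congr rfl fun p _ => ?_
  simp only [addRightEmbedding_apply, Prod.fst_add, Prod.snd_add, sub_eq_add_neg]

/-- An element of `Q_{k+2}` is forced in if it lies below one of its two neighbours in the first
coordinate direction that belongs to `A`; an element of `Q_k` is not forced out if both of the
neighbours below it in that direction belong to `A`. -/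
theorem prod_lowerPart_mul_prod_upperPart {R : Type*} [CommMonoid R] (hA : A ⊆ layer (k + 1))
    (g : ℤ → ℤ → R) :
    (∏ q ∈ lowerPart Covers (layer (k + 2)) A, g q.1 q.2.1) *
        ∏ q ∈ upperPart Covers (layer (k + 1)) (layer k) A, g q.1 q.2.1 =
      ∏ p ∈ A, (g (p.1 + 1) p.2.1 * g (p.1 - 1) p.2.1) := by
  have := prod_mul_prod_of_or_of_and 1 0 (-1)
    (by simpa using mem_lowerPart_succ hA)
    (by simpa [sub_eq_add_neg] using mem_upperPart_pred hA) g
  simpa using this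

/-- The counterpart of `prod_lowerPart_mul_prod_upperPart` under the duality that reverses the order,
exchanges the first two coordinates and replaces `A` by its complement. -/
theorem prod_compl_upperPart_mul_prod_compl_lowerPart {R : Type*} [CommMonoid R]
    (hA : A ⊆ layer (k + 1)) (g : ℤ → ℤ → R) :
    (∏ q ∈ layer (k + 2) \ upperPart Covers (layer (k + 1)) (layer (k + 2)) A, g q.1 q.2.1) *
        ∏ q ∈ layer k \ lowerPart Covers (layer k) A, g q.1 q.2.1 =
      ∏ p ∈ layer (k + 1) \ A, (g p.1 (p.2.1 + 1) * g p.1 (p.2.1 - 1)) := by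
  have := prod_mul_prod_of_or_of_and 0 1 1 (A := layer (k + 1) \ A)
    (by simpa only [sub_zero, add_zero] using mem_compl_upperPart_succ (k := k) (A := A))
    (by simpa only [sub_zero, add_zero] using mem_compl_lowerPart_pred hA) g
  simpa using this

/-- The elements of `Q_{k+2}` that are minimal in `Q_{k+2} ∪ Q_{k+1}` form its bottom row. -/
theorem prod_upperPart_empty {R : Type*} [CommMonoid R] (k : ℕ) (g : ℤ → ℤ → R) :
    ∏ q ∈ upperPart Covers (layer (k + 1)) (layer (k + 2)) ∅, g q.1 q.2.1 =
      ∏ m ∈ Finset.range (k + 1), g (2 * m - k) 0 := by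
  symm
  refine Finset.prod_bij (fun m _ => (2 * (m : ℤ) - k, 0, -(k : ℤ))) ?_ ?_ ?_ ?_
  · intro m hm
    rw [Finset.mem_range] at hm
    simp only [mem_upperPart, Prod.forall, covers_iff, Finset.notMem_empty]
    refine ⟨by rw [mem_layer_iff]; omega, fun r s t hp h => ?_⟩
    rw [mem_layer_iff] at hp
    omega
  · intro m _ m' _ h
    simp only [Prod.mk.injEq] at h
    omega
  · rintro ⟨r, s, t⟩ hq
    have hc := mem_compl_upperPart_succ (k := k) (A := ∅) r s t
    have hq' := upperPart_subset _ _ _ _ hq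
    simp only [Finset.mem_sdiff, hq', hq, not_true, and_false, false_iff, not_or,
      Finset.notMem_empty, not_false_eq_true, and_true] at hc
    simp only [mem_layer_iff] at hc hq'
    refine ⟨((r + k) / 2).toNat, ?_, ?_⟩
    · rw [Finset.mem_range]
      omega
    · simp only [Prod.mk.injEq]
      omega
  · simp

/-- The complements are removed from `prod_compl_upperPart_mul_prod_compl_lowerPart` by comparison
with the case `A = ∅`, which costs the factor of the bottom row of `Q_{k+2}`. -/
theorem prod_upperPart_mul_prod_lowerPart {K : Type*} [Field K] {k : ℕ} (hA : A ⊆ layer (k + 1))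
    (g : ℤ → ℤ → K) (hg : ∀ r s : ℤ, Even (r + s - k) → g r s ≠ 0) :
    (∏ q ∈ upperPart Covers (layer (k + 1)) (layer (k + 2)) A, g q.1 q.2.1) *
        ∏ q ∈ lowerPart Covers (layer k) A, g q.1 q.2.1 =
      (∏ m ∈ Finset.range (k + 1), g (2 * m - k) 0) *
        ∏ p ∈ A, (g p.1 (p.2.1 + 1) * g p.1 (p.2.1 - 1)) := by
  have h0 := prod_compl_upperPart_mul_prod_compl_lowerPart
    (Finset.empty_subset (layer ((k : ℤ) + 1))) g
  have h1 := prod_compl_upperPart_mul_prod_compl_lowerPart hA g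
  have h2 := Finset.prod_sdiff (f := fun q : ℤ × ℤ × ℤ => g q.1 q.2.1)
    (upperPart_subset Covers (layer ((k : ℤ) + 1)) (layer ((k : ℤ) + 2)) ∅)
  have h3 := Finset.prod_sdiff (f := fun q : ℤ × ℤ × ℤ => g q.1 q.2.1)
    (upperPart_subset Covers (layer ((k : ℤ) + 1)) (layer ((k : ℤ) + 2)) A)
  have h4 := Finset.prod_sdiff (f := fun q : ℤ × ℤ × ℤ => g q.1 q.2.1)
    (lowerPart_subset Covers (layer (k : ℤ)) A)
  have h5 := Finset.prod_sdiff
    (f := fun p : ℤ × ℤ × ℤ => g p.1 (p.2.1 + 1) * g p.1 (p.2.1 - 1)) hA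
  have h6 : lowerPart Covers (layer (k : ℤ)) ∅ = ∅ := by simp [lowerPart]
  rw [h6, Finset.sdiff_empty, Finset.sdiff_empty] at h0
  rw [prod_upperPart_empty] at h2
  have hne : ∏ p ∈ layer (k + 1) \ A, (g p.1 (p.2.1 + 1) * g p.1 (p.2.1 - 1)) ≠ 0 := by
    rw [Finset.prod_ne_zero_iff]
    rintro ⟨r, s, t⟩ hp
    have hp' := (Finset.mem_sdiff.1 hp).1
    rw [mem_layer_iff] at hp'
    refine mul_ne_zero (hg _ _ ?_) (hg _ _ ?_) <;> (rw [Int.even_iff]; dsimp only; omega)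
  -- all products over complements are now compared after multiplication by one of them
  apply mul_left_cancel₀ hne
  set e := ∏ p ∈ layer ((k : ℤ) + 1) \ A, (g p.1 (p.2.1 + 1) * g p.1 (p.2.1 - 1))
  set u := ∏ q ∈ upperPart Covers (layer ((k : ℤ) + 1)) (layer (k + 2)) A, g q.1 q.2.1
  set l := ∏ q ∈ lowerPart Covers (layer (k : ℤ)) A, g q.1 q.2.1
  set c := ∏ m ∈ Finset.range (k + 1), g (2 * m - k) 0
  linear_combination (-(u * l)) * h1 +
    (∏ q ∈ layer (k : ℤ) \ lowerPart Covers (layer k) A, g q.1 q.2.1) * l * (h3 - h2) +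
    (∏ q ∈ layer ((k : ℤ) + 2) \ upperPart Covers (layer (k + 1)) (layer (k + 2)) ∅,
      g q.1 q.2.1) * c * h4 + c * h0 - c * h5

end Layers

/-- The generating function of order ideals of `P_{k+1}` equals, up to an explicit factor, that of
`P_k` for the weights mutated at all sites of one colour. The terms with the same trace on the
common layer `Q_{k+1}` are compared: the layers `Q_{k+2}` and `Q_k` are summed out. -/
theorem sum_orderIdeals_succ_eq_mutate {K : Type*} [Field K] (k : ℕ) (Y Y' : ℤ → ℤ → K)
    (hY : ∀ r s : ℤ, Even (r + s - k) → Y r s ≠ 0)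
    (hY1 : ∀ r s : ℤ, Even (r + s - k) → 1 + Y r s ≠ 0)
    (heven : ∀ r s : ℤ, Even (r + s - k) → Y' r s = (Y r s)⁻¹)
    (hodd : ∀ r s : ℤ, Odd (r + s - k) → Y' r s = Y r s *
      ((1 + Y r (s + 1)) * (1 + Y r (s - 1))) * (Y (r + 1) s * Y (r - 1) s) /
      ((1 + Y (r + 1) s) * (1 + Y (r - 1) s))) :
    ∑ I ∈ orderIdeals (k + 1), ∏ p ∈ I, Y p.1 p.2.1 =
      (∏ m ∈ Finset.range (k + 1), (1 + Y (2 * m - k) 0)) *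
        ∑ I ∈ orderIdeals k, ∏ p ∈ I, Y' p.1 p.2.1 := by
  rw [sum_orderIdeals_eq (k := (k : ℤ) + 1) (a := k + 1) (b := k + 2) (by omega),
    sum_orderIdeals_eq (k := (k : ℤ)) (a := k + 1) (b := k) (by omega), Finset.mul_sum]
  refine Finset.sum_congr rfl fun A hA => ?_
  rw [Finset.mem_powerset] at hA
  have hiff := lowerPart_subset_upperPart_iff hA
  by_cases hLU : lowerPart Covers (layer ((k : ℤ) + 2)) A ⊆
    upperPart Covers (layer (k + 1)) (layer (k + 2)) A
  swap
  · rw [if_neg hLU, if_neg (fun h => hLU (hiff.2 h)), mul_zero, mul_zero, mul_zero]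
  have hLU' := hiff.1 hLU
  rw [if_pos hLU, if_pos hLU']
  have e1 := prod_lowerPart_mul_prod_upperPart hA Y
  have e2 := prod_lowerPart_mul_prod_upperPart hA (fun r s => 1 + Y r s)
  have e3 := prod_upperPart_mul_prod_lowerPart hA (fun r s => 1 + Y r s) hY1
  have e4 := Finset.prod_sdiff (f := fun q : ℤ × ℤ × ℤ => 1 + Y q.1 q.2.1) hLU
  have e5 := Finset.prod_sdiff (f := fun q : ℤ × ℤ × ℤ => 1 + Y q.1 q.2.1) hLU'
  have e6 := Finset.prod_sdiff (f := fun q : ℤ × ℤ × ℤ => Y q.1 q.2.1) hLU'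
  have hsite : ∀ {l : ℤ}, (l = k ∨ l = k + 2) → ∀ q ∈ layer l, Even (q.1 + q.2.1 - k) := by
    rintro l hl ⟨r, s, t⟩ hq
    rw [mem_layer_iff] at hq
    rw [Int.even_iff]
    dsimp only
    omega
  have hL := lowerPart_subset Covers (layer ((k : ℤ) + 2)) A
  have hL' := lowerPart_subset Covers (layer (k : ℤ)) A
  have hU' := upperPart_subset Covers (layer ((k : ℤ) + 1)) (layer (k : ℤ)) A
  have e7 : ∏ q ∈ lowerPart Covers (layer (k : ℤ)) A, Y' q.1 q.2.1 =
      (∏ q ∈ lowerPart Covers (layer (k : ℤ)) A, Y q.1 q.2.1)⁻¹ := by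
    rw [← Finset.prod_inv_distrib]
    exact Finset.prod_congr rfl fun q hq => heven _ _ (hsite (Or.inl rfl) q (hL' hq))
  have e8 : ∏ q ∈ upperPart Covers (layer ((k : ℤ) + 1)) (layer k) A \
        lowerPart Covers (layer k) A, (1 + Y' q.1 q.2.1) =
      (∏ q ∈ upperPart Covers (layer ((k : ℤ) + 1)) (layer k) A \
        lowerPart Covers (layer k) A, (1 + Y q.1 q.2.1)) /
      ∏ q ∈ upperPart Covers (layer ((k : ℤ) + 1)) (layer k) A \
        lowerPart Covers (layer k) A, Y q.1 q.2.1 := by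
    rw [← Finset.prod_div_distrib]
    refine Finset.prod_congr rfl fun q hq => ?_
    have hq' := hsite (Or.inl rfl) q (hU' (Finset.mem_sdiff.1 hq).1)
    rw [heven _ _ hq']
    field_simp [hY _ _ hq']
    ring
  have e9 : ∏ p ∈ A, Y' p.1 p.2.1 = (∏ p ∈ A, Y p.1 p.2.1) *
      (∏ p ∈ A, ((1 + Y p.1 (p.2.1 + 1)) * (1 + Y p.1 (p.2.1 - 1)))) *
      (∏ p ∈ A, (Y (p.1 + 1) p.2.1 * Y (p.1 - 1) p.2.1)) /
      ∏ p ∈ A, ((1 + Y (p.1 + 1) p.2.1) * (1 + Y (p.1 - 1) p.2.1)) := by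
    rw [← Finset.prod_mul_distrib, ← Finset.prod_mul_distrib, ← Finset.prod_div_distrib]
    refine Finset.prod_congr rfl fun p hp => hodd _ _ ?_
    obtain ⟨r, s, t⟩ := p
    have := hA hp
    rw [mem_layer_iff] at this
    rw [Int.odd_iff]
    dsimp only
    omega
  have n1 : ∏ q ∈ upperPart Covers (layer ((k : ℤ) + 1)) (layer k) A, Y q.1 q.2.1 ≠ 0 :=
    Finset.prod_ne_zero_iff.2 fun q hq => hY _ _ (hsite (Or.inl rfl) q (hU' hq))
  have n2 : ∏ q ∈ upperPart Covers (layer ((k : ℤ) + 1)) (layer k) A, (1 + Y q.1 q.2.1) ≠ 0 :=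
    Finset.prod_ne_zero_iff.2 fun q hq => hY1 _ _ (hsite (Or.inl rfl) q (hU' hq))
  have n3 : ∏ q ∈ lowerPart Covers (layer ((k : ℤ) + 2)) A, (1 + Y q.1 q.2.1) ≠ 0 :=
    Finset.prod_ne_zero_iff.2 fun q hq => hY1 _ _ (hsite (Or.inr rfl) q (hL hq))
  rw [e7, e8, e9, ← e1, ← e2]
  rw [← e6] at n1 ⊢
  rw [← e5] at n2 ⊢
  rw [← e4] at e3
  set c := ∏ m ∈ Finset.range (k + 1), (1 + Y (2 * m - k) 0)
  set h := ∏ p ∈ A, ((1 + Y p.1 (p.2.1 + 1)) * (1 + Y p.1 (p.2.1 - 1)))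
  have n4 := left_ne_zero_of_mul n1
  have n5 := right_ne_zero_of_mul n1
  have n6 := left_ne_zero_of_mul n2
  have n7 := right_ne_zero_of_mul n2
  field_simp
  linear_combination (∏ p ∈ A, Y p.1 p.2.1) *
    (∏ q ∈ lowerPart Covers (layer ((k : ℤ) + 2)) A, Y q.1 q.2.1) * e3

/-! ### Homogeneous coordinates -/

/-- The determinant of three vectors, as a triple product. -/
noncomputable def tdet (u v w : Fin 3 → ℝ) : ℝ := u ⬝ᵥ crossProduct v w

theorem tdet_def (u v w : Fin 3 → ℝ) : tdet u v w =
    u 0 * (v 1 * w 2 - v 2 * w 1) + u 1 * (v 2 * w 0 - v 0 * w 2) +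
      u 2 * (v 0 * w 1 - v 1 * w 0) := by
  simp [tdet, cross_apply, dotProduct, Fin.sum_univ_three]

theorem cross_zero (u v : Fin 3 → ℝ) : crossProduct u v 0 = u 1 * v 2 - u 2 * v 1 := by
  simp [cross_apply]

theorem cross_one (u v : Fin 3 → ℝ) : crossProduct u v 1 = u 2 * v 0 - u 0 * v 2 := by
  simp [cross_apply]

theorem cross_two (u v : Fin 3 → ℝ) : crossProduct u v 2 = u 0 * v 1 - u 1 * v 0 := by
  simp [cross_apply]

theorem tdet_rotate (u v w : Fin 3 → ℝ) : tdet u v w = tdet v w u := by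
  simp only [tdet_def]; ring

theorem tdet_swap (u v w : Fin 3 → ℝ) : tdet v u w = -tdet u v w := by
  simp only [tdet_def]; ring

theorem tdet_comb_comb (n a b : Fin 3 → ℝ) (α β γ δ : ℝ) :
    tdet n (α • a + β • b) (γ • a + δ • b) = (α * δ - β * γ) * tdet n a b := by
  simp only [tdet_def, Pi.add_apply, Pi.smul_apply, smul_eq_mul]; ring

theorem cross_cross_eq_comb (p q a b : Fin 3 → ℝ) :
    crossProduct (crossProduct p q) (crossProduct a b) =
      tdet p q b • a + (-tdet p q a) • b := by
  ext i
  fin_cases i <;>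
    simp only [tdet_def, Pi.add_apply, Pi.smul_apply, smul_eq_mul, Fin.zero_eta, Fin.mk_one,
      Fin.reduceFinMk, cross_zero, cross_one, cross_two] <;> ring

/-- The quadratic relation between the determinants of five vectors. -/
theorem tdet_plucker (q p r a b : Fin 3 → ℝ) :
    tdet p q a * tdet q r b - tdet p q b * tdet q r a = tdet p q r * tdet a b q := by
  simp only [tdet_def]; ring

theorem tdet_cross_cross_self (p u w : Fin 3 → ℝ) :
    tdet p (crossProduct p u) (crossProduct p w) = tdet p u w * (p ⬝ᵥ p) := by
  simp only [tdet_def, cross_zero, cross_one, cross_two, dotProduct, Fin.sum_univ_three]; ring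

theorem cross_ne_zero_of_tdet_ne_zero {u v w : Fin 3 → ℝ} (h : tdet u v w ≠ 0) :
    crossProduct v w ≠ 0 := by
  rintro h0
  simp [tdet, h0] at h

theorem dotProduct_self_ne_zero {u : Fin 3 → ℝ} (h : u ≠ 0) : u ⬝ᵥ u ≠ 0 := by
  rwa [Ne, dotProduct_self_eq_zero]

/-- The vector `v` consists of homogeneous coordinates of `P`. -/
def IsRep (P : Projectivization ℝ (Fin 3 → ℝ)) (v : Fin 3 → ℝ) : Prop :=
  ∃ h : v ≠ 0, P = Projectivization.mk ℝ v h

theorem isRep_rep (P : Projectivization ℝ (Fin 3 → ℝ)) : IsRep P P.rep :=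
  ⟨P.rep_nonzero, P.mk_rep.symm⟩

theorem IsRep.cross {P Q : Projectivization ℝ (Fin 3 → ℝ)} {u v : Fin 3 → ℝ} (hP : IsRep P u)
    (hQ : IsRep Q v) (h : crossProduct u v ≠ 0) :
    IsRep (Projectivization.cross P Q) (crossProduct u v) := by
  obtain ⟨hu, rfl⟩ := hP
  obtain ⟨hv, rfl⟩ := hQ
  exact ⟨h, Projectivization.cross_mk_of_cross_ne_zero hu hv h⟩

theorem IsRep.rep_eq {P : Projectivization ℝ (Fin 3 → ℝ)} {v : Fin 3 → ℝ} (h : IsRep P v) :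
    ∃ c : ℝ, c ≠ 0 ∧ P.rep = c • v := by
  obtain ⟨hv, rfl⟩ := h
  obtain ⟨c, hc⟩ := (Projectivization.mk_eq_mk_iff' ℝ _ _ (Projectivization.rep_nonzero _) hv).1
    (Projectivization.mk_rep (Projectivization.mk ℝ v hv))
  refine ⟨c, ?_, hc.symm⟩
  rintro rfl
  exact (Projectivization.mk ℝ v hv).rep_nonzero (by rw [← hc, zero_smul])

/-- The cross ratio can be computed with any homogeneous coordinates. -/
theorem crossRatio_eq {n a b c d : Projectivization ℝ (Fin 3 → ℝ)} {n' a' b' c' d' : Fin 3 → ℝ}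
    (hn : IsRep n n') (ha : IsRep a a') (hb : IsRep b b') (hc : IsRep c c') (hd : IsRep d d') :
    crossRatio n a b c d =
      (tdet n' a' b' * tdet n' c' d') / (tdet n' a' c' * tdet n' b' d') := by
  obtain ⟨xn, hxn, en⟩ := hn.rep_eq
  obtain ⟨xa, hxa, ea⟩ := ha.rep_eq
  obtain ⟨xb, hxb, eb⟩ := hb.rep_eq
  obtain ⟨xc, hxc, ec⟩ := hc.rep_eq
  obtain ⟨xd, hxd, ed⟩ := hd.rep_eq
  have key : ∀ (x y z : ℝ) (u v w : Fin 3 → ℝ), (x • u) ⬝ᵥ crossProduct (y • v) (z • w) =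
      x * y * z * tdet u v w := by
    intro x y z u v w
    simp only [tdet, map_smul, LinearMap.smul_apply, smul_dotProduct, dotProduct_smul, smul_eq_mul]
    ring
  rw [crossRatio, bracket, bracket, bracket, bracket, en, ea, eb, ec, ed, key, key, key, key]
  rw [show xn * xa * xb * tdet n' a' b' * (xn * xc * xd * tdet n' c' d') =
      (xn * xn * xa * xb * xc * xd) * (tdet n' a' b' * tdet n' c' d') by ring,
    show xn * xa * xc * tdet n' a' c' * (xn * xb * xd * tdet n' b' d') =
      (xn * xn * xa * xb * xc * xd) * (tdet n' a' c' * tdet n' b' d') by ring]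
  exact mul_div_mul_left _ _ (by positivity)

theorem collinear3_iff {P Q R : Point} {u v w : Fin 3 → ℝ} (hP : IsRep P u) (hQ : IsRep Q v)
    (hR : IsRep R w) : Collinear3 P Q R ↔ tdet u v w = 0 := by
  obtain ⟨hu, rfl⟩ := hP
  obtain ⟨hv, rfl⟩ := hQ
  obtain ⟨hw, rfl⟩ := hR
  have hdet : tdet u v w = (Matrix.of ![u, v, w]).det := triple_product_eq_det u v w
  rw [hdet, ← Matrix.exists_mulVec_eq_zero_iff]
  have key : ∀ z : Fin 3 → ℝ,
      (Matrix.of ![u, v, w]).mulVec z = 0 ↔ u ⬝ᵥ z = 0 ∧ v ⬝ᵥ z = 0 ∧ w ⬝ᵥ z = 0 := by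
    intro z
    rw [funext_iff, Fin.forall_fin_succ, Fin.forall_fin_two]
    exact Iff.rfl
  constructor
  · rintro ⟨ℓ, h1, h2, h3⟩
    obtain ⟨z, hz, rfl⟩ : ∃ z, IsRep ℓ z := ⟨_, isRep_rep ℓ⟩
    exact ⟨z, hz, (key z).2 ⟨h1, h2, h3⟩⟩
  · rintro ⟨z, hz, h⟩
    obtain ⟨h1, h2, h3⟩ := (key z).1 h
    exact ⟨Projectivization.mk ℝ z hz, h1, h2, h3⟩

/-! ### Cross ratios as quotients of determinants -/

theorem isRep_join {P Q : Point} {u v : Fin 3 → ℝ} (hP : IsRep P u) (hQ : IsRep Q v)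
    (h : crossProduct u v ≠ 0) : IsRep (join P Q) (crossProduct u v) := hP.cross hQ h

theorem isRep_meet_join {P Q A B : Point} {p q a b : Fin 3 → ℝ} (hP : IsRep P p) (hQ : IsRep Q q)
    (hA : IsRep A a) (hB : IsRep B b) (hab : crossProduct a b ≠ 0)
    (h : tdet p q a ≠ 0 ∨ tdet p q b ≠ 0) :
    IsRep (meet (join P Q) (join A B)) (tdet p q b • a + (-tdet p q a) • b) := by
  have hpq : crossProduct p q ≠ 0 := by
    rcases h with h | h <;> rw [tdet_rotate, tdet_rotate] at h <;>
      exact cross_ne_zero_of_tdet_ne_zero h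
  rw [← cross_cross_eq_comb]
  refine (isRep_join hP hQ hpq).cross (isRep_join hA hB hab) ?_
  rw [cross_cross_eq_comb]
  have hN := dotProduct_self_ne_zero hab
  have hN : tdet (crossProduct a b) a b ≠ 0 := dotProduct_self_ne_zero hab
  have hz : ∀ u : Fin 3 → ℝ, tdet (crossProduct a b) u 0 = 0 := fun u => by simp [tdet]
  intro h0
  have h1 := tdet_comb_comb (crossProduct a b) a b 1 0 (tdet p q b) (-tdet p q a)
  have h2 := tdet_comb_comb (crossProduct a b) a b 0 1 (tdet p q b) (-tdet p q a)
  rw [h0, hz] at h1 h2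
  rcases h with h | h
  · exact mul_ne_zero h hN (by linarith)
  · exact mul_ne_zero h hN (by linarith)

/-- The cross ratio that defines the `x`-coordinates. -/
theorem crossRatio_x {A B P Q R : Point} {a b p q r : Fin 3 → ℝ} (hA : IsRep A a)
    (hB : IsRep B b) (hP : IsRep P p) (hQ : IsRep Q q) (hR : IsRep R r) (h1 : tdet p q a ≠ 0)
    (h2 : tdet q r b ≠ 0) (h3 : tdet a b q ≠ 0) :
    crossRatio (join A B) A B (meet (join P Q) (join A B)) (meet (join Q R) (join A B)) =
      tdet p q r * tdet a b q / (tdet p q a * tdet q r b) := by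
  have hab : crossProduct a b ≠ 0 := by
    rw [tdet_rotate, tdet_rotate] at h3
    exact cross_ne_zero_of_tdet_ne_zero h3
  rw [crossRatio_eq (isRep_join hA hB hab) hA hB (isRep_meet_join hP hQ hA hB hab (Or.inl h1))
    (isRep_meet_join hQ hR hA hB hab (Or.inr h2)), tdet_comb_comb]
  have e1 := tdet_comb_comb (crossProduct a b) a b 1 0 (tdet p q b) (-tdet p q a)
  have e2 := tdet_comb_comb (crossProduct a b) a b 0 1 (tdet q r b) (-tdet q r a)
  simp only [one_smul, zero_smul, add_zero, zero_add] at e1 e2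
  simp only [one_mul, zero_mul, sub_zero, zero_sub] at e1 e2
  rw [e1, e2, ← tdet_plucker q p r a b]
  have hN : tdet (crossProduct a b) a b ≠ 0 := dotProduct_self_ne_zero hab
  generalize tdet (crossProduct a b) a b = N at hN
  field_simp
  ring

/-- The cross ratio that defines the `y`-parameter of a vertex. -/
theorem crossRatio_y_vertex {P A B C D : Point} {p a b c d : Fin 3 → ℝ} (hP : IsRep P p)
    (hA : IsRep A a) (hB : IsRep B b) (hC : IsRep C c) (hD : IsRep D d)
    (h1 : tdet p a b ≠ 0) (h2 : tdet p c d ≠ 0) :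
    crossRatio P (join P A) (join P B) (join P C) (join P D) =
      tdet p a b * tdet p c d / (tdet p a c * tdet p b d) := by
  have key : ∀ {u v : Fin 3 → ℝ}, tdet p u v ≠ 0 →
      crossProduct p u ≠ 0 ∧ crossProduct p v ≠ 0 := by
    intro u v h
    refine ⟨cross_ne_zero_of_tdet_ne_zero (u := v) (by rwa [tdet_rotate]),
      cross_ne_zero_of_tdet_ne_zero (u := u) (by rwa [tdet_swap, neg_ne_zero])⟩
  rw [crossRatio_eq hP (isRep_join hP hA (key h1).1) (isRep_join hP hB (key h1).2)
    (isRep_join hP hC (key h2).1) (isRep_join hP hD (key h2).2)]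
  simp only [tdet_cross_cross_self]
  have hp := dotProduct_self_ne_zero hP.1
  rw [show tdet p a b * (p ⬝ᵥ p) * (tdet p c d * (p ⬝ᵥ p)) =
      ((p ⬝ᵥ p) * (p ⬝ᵥ p)) * (tdet p a b * tdet p c d) by ring,
    show tdet p a c * (p ⬝ᵥ p) * (tdet p b d * (p ⬝ᵥ p)) =
      ((p ⬝ᵥ p) * (p ⬝ᵥ p)) * (tdet p a c * tdet p b d) by ring]
  exact mul_div_mul_left _ _ (mul_ne_zero hp hp)

/-- The cross ratio that defines the `y`-parameter of an edge. -/
theorem crossRatio_y_edge {A B P Q C D : Point} {a b p q c d : Fin 3 → ℝ} (hA : IsRep A a)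
    (hB : IsRep B b) (hP : IsRep P p) (hQ : IsRep Q q) (hC : IsRep C c) (hD : IsRep D d)
    (h1 : tdet a b p ≠ 0) (h2 : tdet c d q ≠ 0) (h3 : tdet b p q ≠ 0) :
    crossRatio (join P Q) (meet (join A B) (join P Q)) P Q (meet (join C D) (join P Q)) =
      tdet a b p * tdet c d q / (tdet a b q * tdet c d p) := by
  have hpq := cross_ne_zero_of_tdet_ne_zero h3
  rw [crossRatio_eq (isRep_join hP hQ hpq) (isRep_meet_join hA hB hP hQ hpq (Or.inl h1)) hP hQ
    (isRep_meet_join hC hD hP hQ hpq (Or.inr h2))]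
  have e1 := tdet_comb_comb (crossProduct p q) p q (tdet a b q) (-tdet a b p) 1 0
  have e2 := tdet_comb_comb (crossProduct p q) p q (tdet a b q) (-tdet a b p) 0 1
  have e3 := tdet_comb_comb (crossProduct p q) p q 1 0 (tdet c d q) (-tdet c d p)
  have e4 := tdet_comb_comb (crossProduct p q) p q 0 1 (tdet c d q) (-tdet c d p)
  simp only [one_smul, zero_smul, add_zero, zero_add] at e1 e2 e3 e4
  rw [e1, e2, e3, e4]
  have hN : tdet (crossProduct p q) p q ≠ 0 := dotProduct_self_ne_zero hpq
  generalize tdet (crossProduct p q) p q = N at hN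
  rw [show (tdet a b q * 0 - -tdet a b p * 1) * N * ((0 * -tdet c d p - 1 * tdet c d q) * N) =
      (-(N * N)) * (tdet a b p * tdet c d q) by ring,
    show (tdet a b q * 1 - -tdet a b p * 0) * N * ((1 * -tdet c d p - 0 * tdet c d q) * N) =
      (-(N * N)) * (tdet a b q * tdet c d p) by ring]
  exact mul_div_mul_left _ _ (neg_ne_zero.2 (mul_ne_zero hN hN))

/-! ### Coordinates of a generic polygon in terms of determinants -/

/-- The vectors `v i` are homogeneous coordinates of the vertices of `A`, and any three of four
consecutive ones are linearly independent. The indices in the last three fields are kept separate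
from the equations between them, so that any form of an index is accepted. -/
structure GenericLift (A : Polygon) (v : ℤ → Fin 3 → ℝ) : Prop where
  isRep : ∀ i, IsRep (A.pt i) (v i)
  ne_012 : ∀ {i j k : ℤ}, j = i + 1 → k = i + 2 → tdet (v i) (v j) (v k) ≠ 0
  ne_013 : ∀ {i j k : ℤ}, j = i + 1 → k = i + 3 → tdet (v i) (v j) (v k) ≠ 0
  ne_023 : ∀ {i j k : ℤ}, j = i + 2 → k = i + 3 → tdet (v i) (v j) (v k) ≠ 0

theorem Polygon.IsGeneric.genericLift {A : Polygon} (hA : A.IsGeneric) {v : ℤ → Fin 3 → ℝ}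
    (hv : ∀ i, IsRep (A.pt i) (v i)) : GenericLift A v where
  isRep := hv
  ne_012 := by
    rintro i _ _ rfl rfl h
    exact (hA i).1 ((collinear3_iff (hv _) (hv _) (hv _)).2 h)
  ne_013 := by
    rintro i _ _ rfl rfl h
    exact (hA i).2.1 ((collinear3_iff (hv _) (hv _) (hv _)).2 h)
  ne_023 := by
    rintro i _ _ rfl rfl h
    exact (hA i).2.2.1 ((collinear3_iff (hv _) (hv _) (hv _)).2 h)

section Coordinates

variable {A : Polygon} {v : ℤ → Fin 3 → ℝ} {i a b q r s : ℤ}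

theorem GenericLift.xEven_eq (h : GenericLift A v) (ha : a = i - 2) (hb : b = i - 1)
    (hq : q = i + 1) (hr : r = i + 2) :
    A.xEven i = tdet (v i) (v q) (v r) * tdet (v a) (v b) (v q) /
      (tdet (v a) (v i) (v q) * tdet (v b) (v q) (v r)) := by
  have h1 : tdet (v a) (v i) (v q) ≠ 0 := h.ne_023 (by omega) (by omega)
  have h2 : tdet (v b) (v q) (v r) ≠ 0 := h.ne_023 (by omega) (by omega)
  have h3 : tdet (v a) (v b) (v q) ≠ 0 := h.ne_013 (by omega) (by omega)
  rw [tdet_rotate] at h1 h2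
  rw [Polygon.xEven, ← ha, ← hb, ← hq, ← hr, tdet_rotate (v a) (v i), tdet_rotate (v b) (v q)]
  exact crossRatio_x (h.isRep _) (h.isRep _) (h.isRep _) (h.isRep _) (h.isRep _) h1 h2 h3

theorem GenericLift.xOdd_eq (h : GenericLift A v) (ha : a = i - 2) (hb : b = i - 1)
    (hq : q = i + 1) (hr : r = i + 2) :
    A.xOdd i = tdet (v a) (v b) (v i) * tdet (v b) (v q) (v r) /
      (tdet (v b) (v i) (v r) * tdet (v a) (v b) (v q)) := by
  have h1 : tdet (v b) (v i) (v r) ≠ 0 := h.ne_013 (by omega) (by omega)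
  have h2 : tdet (v a) (v b) (v q) ≠ 0 := h.ne_013 (by omega) (by omega)
  have h3 : tdet (v b) (v q) (v r) ≠ 0 := h.ne_023 (by omega) (by omega)
  have e1 : tdet (v i) (v b) (v r) = -tdet (v b) (v i) (v r) := tdet_swap _ _ _
  have e2 : tdet (v b) (v a) (v q) = -tdet (v a) (v b) (v q) := tdet_swap _ _ _
  have e3 : tdet (v r) (v q) (v b) = -tdet (v b) (v q) (v r) := by
    rw [tdet_swap, ← tdet_rotate]
  have e4 : tdet (v i) (v b) (v a) = -tdet (v a) (v b) (v i) := by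
    rw [tdet_swap, ← tdet_rotate]
  rw [Polygon.xOdd, ← ha, ← hb, ← hq, ← hr]
  have := crossRatio_x (h.isRep r) (h.isRep q) (h.isRep i) (h.isRep b) (h.isRep a)
    (by rwa [e1, neg_ne_zero]) (by rwa [e2, neg_ne_zero]) (by rwa [e3, neg_ne_zero])
  rw [e1, e2, e3, e4, neg_mul_neg, neg_mul_neg] at this
  exact this

theorem GenericLift.yVertex_eq (h : GenericLift A v) (ha : a = i - 2) (hb : b = i - 1)
    (hq : q = i + 1) (hr : r = i + 2) :
    A.yVertex i = -(tdet (v a) (v i) (v q) * tdet (v b) (v i) (v r) /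
      (tdet (v a) (v b) (v i) * tdet (v i) (v q) (v r))) := by
  have h1 : tdet (v a) (v b) (v i) ≠ 0 := h.ne_012 (by omega) (by omega)
  have h2 : tdet (v i) (v q) (v r) ≠ 0 := h.ne_012 (by omega) (by omega)
  have e1 : tdet (v i) (v a) (v b) = tdet (v a) (v b) (v i) := tdet_rotate _ _ _
  have e2 : tdet (v i) (v a) (v q) = -tdet (v a) (v i) (v q) := tdet_swap _ _ _
  have e3 : tdet (v i) (v b) (v r) = -tdet (v b) (v i) (v r) := tdet_swap _ _ _
  rw [Polygon.yVertex, ← ha, ← hb, ← hq, ← hr]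
  rw [crossRatio_y_vertex (h.isRep i) (h.isRep a) (h.isRep b) (h.isRep q) (h.isRep r)
    (by rwa [e1]) h2, e1, e2, e3, neg_mul_neg, inv_div]

theorem GenericLift.yEdge_eq (h : GenericLift A v) (ha : a = i - 2) (hb : b = i - 1)
    (hq : q = i + 1) (hr : r = i + 2) (hs : s = i + 3) :
    A.yEdge i = -(tdet (v a) (v b) (v i) * tdet (v q) (v r) (v s) /
      (tdet (v a) (v b) (v q) * tdet (v i) (v r) (v s))) := by
  have h1 : tdet (v a) (v b) (v i) ≠ 0 := h.ne_012 (by omega) (by omega)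
  have h2 : tdet (v q) (v r) (v s) ≠ 0 := h.ne_012 (by omega) (by omega)
  have h3 : tdet (v b) (v i) (v q) ≠ 0 := h.ne_012 (by omega) (by omega)
  rw [Polygon.yEdge, ← ha, ← hb, ← hq, ← hr, ← hs, tdet_rotate (v q), tdet_rotate (v i) (v r)]
  rw [tdet_rotate] at h2
  exact congrArg Neg.neg (crossRatio_y_edge (h.isRep _) (h.isRep _) (h.isRep _) (h.isRep _)
    (h.isRep _) (h.isRep _) h1 h2 h3)

theorem GenericLift.xEven_ne_zero (h : GenericLift A v) (i : ℤ) : A.xEven i ≠ 0 := by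
  rw [h.xEven_eq rfl rfl rfl rfl]
  exact div_ne_zero
    (mul_ne_zero (h.ne_012 (by omega) (by omega)) (h.ne_013 (by omega) (by omega)))
    (mul_ne_zero (h.ne_023 (by omega) (by omega)) (h.ne_023 (by omega) (by omega)))

theorem GenericLift.xOdd_ne_zero (h : GenericLift A v) (i : ℤ) : A.xOdd i ≠ 0 := by
  rw [h.xOdd_eq rfl rfl rfl rfl]
  exact div_ne_zero
    (mul_ne_zero (h.ne_012 (by omega) (by omega)) (h.ne_023 (by omega) (by omega)))
    (mul_ne_zero (h.ne_013 (by omega) (by omega)) (h.ne_013 (by omega) (by omega)))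

theorem GenericLift.yVertex_eq_x (h : GenericLift A v) (i : ℤ) :
    A.yVertex i = -(A.xEven i * A.xOdd i)⁻¹ := by
  rw [h.xEven_eq rfl rfl rfl rfl, h.xOdd_eq rfl rfl rfl rfl, h.yVertex_eq rfl rfl rfl rfl]
  have h1 : tdet (v (i - 2)) (v i) (v (i + 1)) ≠ 0 := h.ne_023 (by omega) (by omega)
  have h2 : tdet (v (i - 1)) (v (i + 1)) (v (i + 2)) ≠ 0 := h.ne_023 (by omega) (by omega)
  have h3 : tdet (v (i - 2)) (v (i - 1)) (v (i + 1)) ≠ 0 := h.ne_013 (by omega) (by omega)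
  field_simp

theorem GenericLift.yEdge_eq_x (h : GenericLift A v) (i : ℤ) :
    A.yEdge i = -(A.xOdd i * A.xEven (i + 1)) := by
  rw [h.xEven_eq (i := i + 1) (a := i - 1) (b := i) (q := i + 2) (r := i + 3) (by ring) (by ring)
    (by ring) (by ring), h.xOdd_eq rfl rfl rfl rfl, h.yEdge_eq rfl rfl rfl rfl rfl]
  have h1 : tdet (v (i - 1)) (v i) (v (i + 2)) ≠ 0 := h.ne_013 (by omega) (by omega)
  have h2 : tdet (v (i - 1)) (v (i + 1)) (v (i + 2)) ≠ 0 := h.ne_023 (by omega) (by omega)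
  field_simp

/-- `1 + y` is a single quotient of determinants by the three-term relation
`(a - b)(c - d) - (a - c)(b - d) = -(a - d)(b - c)` for the lines through the vertex. -/
theorem GenericLift.one_add_yVertex_eq (h : GenericLift A v) (ha : a = i - 2) (hb : b = i - 1)
    (hq : q = i + 1) (hr : r = i + 2) :
    1 + A.yVertex i = -(tdet (v a) (v i) (v r) * tdet (v b) (v i) (v q) /
      (tdet (v a) (v b) (v i) * tdet (v i) (v q) (v r))) := by
  have h1 : tdet (v a) (v b) (v i) ≠ 0 := h.ne_012 (by omega) (by omega)
  have h2 : tdet (v i) (v q) (v r) ≠ 0 := h.ne_012 (by omega) (by omega)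
  rw [h.yVertex_eq ha hb hq hr]
  field_simp
  simp only [tdet_def]
  ring

end Coordinates

/-! ### The pentagram map in coordinates -/

/-- The vectors of the diagonals of a polygon with vertex vectors `v`. -/
noncomputable def diag (v : ℤ → Fin 3 → ℝ) (i : ℤ) : Fin 3 → ℝ :=
  crossProduct (v (i - 1)) (v (i + 1))

/-- The vectors of the intersection points of consecutive lines with vectors `l`. -/
noncomputable def corner (l : ℤ → Fin 3 → ℝ) (i : ℤ) : Fin 3 → ℝ :=
  crossProduct (l i) (l (i + 1))

/-- Two lines that share the point `b` meet in it, so this determinant of lines is a monomial. -/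
theorem tdet_cross_cross_cross (a b c d e : Fin 3 → ℝ) :
    tdet (crossProduct a b) (crossProduct b c) (crossProduct d e) =
      tdet a b c * tdet b d e := by
  simp only [tdet_def, cross_zero, cross_one, cross_two]; ring

section Corner

variable (l v : ℤ → Fin 3 → ℝ) {i j k m n p : ℤ}

theorem tdet_corner_012 (hj : j = i + 1) (hk : k = i + 2) (hm : m = i + 3) :
    tdet (corner l i) (corner l j) (corner l k) =
      tdet (l i) (l j) (l k) * tdet (l j) (l k) (l m) := by
  rw [corner, corner, corner, ← hj, show j + 1 = k by omega, show k + 1 = m by omega]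
  exact tdet_cross_cross_cross _ _ _ _ _

theorem tdet_corner_013 (hj : j = i + 1) (hk : k = i + 2) (hm : m = i + 3) (hn : n = i + 4) :
    tdet (corner l i) (corner l j) (corner l m) =
      tdet (l i) (l j) (l k) * tdet (l j) (l m) (l n) := by
  rw [corner, corner, corner, ← hj, show j + 1 = k by omega, show m + 1 = n by omega]
  exact tdet_cross_cross_cross _ _ _ _ _

theorem tdet_corner_023 (hj : j = i + 1) (hk : k = i + 2) (hm : m = i + 3) (hn : n = i + 4) :
    tdet (corner l i) (corner l k) (corner l m) =
      tdet (l i) (l j) (l m) * tdet (l k) (l m) (l n) := by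
  rw [tdet_rotate, corner, corner, corner, ← hj, show k + 1 = m by omega,
    show m + 1 = n by omega, tdet_cross_cross_cross, tdet_rotate (l m), mul_comm]

theorem tdet_diag_012 (hj : j = i + 1) (hk : k = i + 2) (hm : m = i + 3) (hn : n = i + 4) :
    tdet (diag v j) (diag v k) (diag v m) =
      tdet (v i) (v k) (v n) * tdet (v j) (v k) (v m) := by
  rw [diag, diag, diag, show j - 1 = i by omega, show j + 1 = k by omega, show k - 1 = j by omega,
    show k + 1 = m by omega, show m - 1 = k by omega, show m + 1 = n by omega, tdet_swap,
    tdet_rotate, tdet_cross_cross_cross, tdet_swap (v j) (v k)]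
  ring

theorem tdet_diag_023 (hj : j = i + 1) (hk : k = i + 2) (hm : m = i + 3) (hn : n = i + 4)
    (hp : p = i + 5) :
    tdet (diag v j) (diag v m) (diag v n) =
      tdet (v i) (v k) (v n) * tdet (v k) (v m) (v p) := by
  rw [diag, diag, diag, show j - 1 = i by omega, show j + 1 = k by omega, show m - 1 = k by omega,
    show m + 1 = n by omega, show n - 1 = m by omega, show n + 1 = p by omega]
  exact tdet_cross_cross_cross _ _ _ _ _

theorem tdet_diag_013 (hj : j = i + 1) (hk : k = i + 2) (hm : m = i + 3) (hn : n = i + 4)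
    (hp : p = i + 5) :
    tdet (diag v j) (diag v k) (diag v n) =
      tdet (v j) (v m) (v p) * tdet (v i) (v k) (v m) := by
  rw [diag, diag, diag, show j - 1 = i by omega, show j + 1 = k by omega, show k - 1 = j by omega,
    show k + 1 = m by omega, show n - 1 = m by omega, show n + 1 = p by omega, tdet_rotate,
    tdet_cross_cross_cross, tdet_rotate (v m)]

end Corner

section Pentagram

variable {A : Polygon} {v : ℤ → Fin 3 → ℝ}

theorem GenericLift.isRep_pentagram (h : GenericLift A v) (i : ℤ) :
    IsRep (A.pentagram.pt i) (corner (diag v) i) := by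
  have h1 : tdet (v (i - 1)) (v i) (v (i + 1)) ≠ 0 := h.ne_012 (by omega) (by omega)
  have h2 : tdet (v i) (v (i + 1)) (v (i + 2)) ≠ 0 := h.ne_012 (by omega) (by omega)
  have := isRep_meet_join (h.isRep (i - 1)) (h.isRep (i + 1)) (h.isRep i) (h.isRep (i + 2))
    (cross_ne_zero_of_tdet_ne_zero (u := v (i + 1)) (by rwa [tdet_swap, neg_ne_zero]))
    (Or.inl (by rwa [tdet_rotate, tdet_swap, neg_ne_zero, ← tdet_rotate]))
  rw [← cross_cross_eq_comb] at this
  rw [corner, diag, diag, show i + 1 - 1 = i by ring, show i + 1 + 1 = i + 2 by ring]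
  exact this

theorem GenericLift.pentagram (h : GenericLift A v) (hB : A.pentagram.IsGeneric) :
    GenericLift A.pentagram (corner (diag v)) :=
  hB.genericLift h.isRep_pentagram

theorem GenericLift.tdet_diag_ne_zero (h : GenericLift A v) (hB : A.pentagram.IsGeneric)
    {i j k : ℤ} (hj : j = i + 1) (hk : k = i + 2) :
    tdet (diag v i) (diag v j) (diag v k) ≠ 0 := by
  have := (h.pentagram hB).ne_012 hj hk
  rw [tdet_corner_012 (diag v) hj hk rfl] at this
  exact left_ne_zero_of_mul this

/-- If `A` and `T(A)` are generic, then no three alternate vertices of `A` are collinear. -/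
theorem GenericLift.ne_024 (h : GenericLift A v) (hB : A.pentagram.IsGeneric) {i k n : ℤ}
    (hk : k = i + 2) (hn : n = i + 4) : tdet (v i) (v k) (v n) ≠ 0 := by
  have := h.tdet_diag_ne_zero hB (i := i + 1) (j := k) (k := i + 3) (by omega) (by omega)
  rw [tdet_diag_012 v rfl hk rfl hn] at this
  exact left_ne_zero_of_mul this

theorem GenericLift.one_add_yVertex_ne_zero (h : GenericLift A v) (hB : A.pentagram.IsGeneric)
    (i : ℤ) : 1 + A.yVertex i ≠ 0 := by
  rw [h.one_add_yVertex_eq rfl rfl rfl rfl]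
  exact neg_ne_zero.2 (div_ne_zero
    (mul_ne_zero (h.ne_024 hB (by omega) (by omega)) (h.ne_012 (by omega) (by omega)))
    (mul_ne_zero (h.ne_012 (by omega) (by omega)) (h.ne_012 (by omega) (by omega))))

/-- The right-hand side is `x_{j-1} (1 - x_{j-3} x_{j-2}) / (1 - x_{j+1} x_{j+2})`, written with as
many `y`-parameters as the induction needs. -/
theorem GenericLift.xEven_pentagram (h : GenericLift A v) (hB : A.pentagram.IsGeneric) (m : ℤ) :
    A.pentagram.xEven m = A.xEven (m - 1) * A.yEdge (m - 1) * A.yVertex (m + 1) *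
      (1 + A.yVertex (m - 1)) / (1 + A.yVertex (m + 1)) := by
  have h' := h.pentagram hB
  -- the determinants of the vertices of `T(A)` are monomials in those of the vertices of `A`
  have e1 := tdet_corner_012 (diag v) (i := m) (j := m + 1) (k := m + 2) (m := m + 3)
    (by omega) (by omega) (by omega)
  have e2 := tdet_corner_013 (diag v) (i := m - 2) (j := m - 1) (k := m) (m := m + 1) (n := m + 2)
    (by omega) (by omega) (by omega) (by omega)
  have e3 := tdet_corner_023 (diag v) (i := m - 2) (j := m - 1) (k := m) (m := m + 1) (n := m + 2)
    (by omega) (by omega) (by omega) (by omega)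
  have e4 := tdet_corner_023 (diag v) (i := m - 1) (j := m) (k := m + 1) (m := m + 2) (n := m + 3)
    (by omega) (by omega) (by omega) (by omega)
  have n1 := h.tdet_diag_ne_zero hB (i := m) (j := m + 1) (k := m + 2) (by omega) (by omega)
  have n2 := h.tdet_diag_ne_zero hB (i := m + 1) (j := m + 2) (k := m + 3) (by omega) (by omega)
  rw [h'.xEven_eq rfl rfl rfl rfl, e1, e2, e3, e4,
    tdet_diag_012 v (i := m - 3) (j := m - 2) (k := m - 1) (m := m) (n := m + 1)
      (by omega) (by omega) (by omega) (by omega),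
    tdet_diag_023 v (i := m - 2) (j := m - 1) (k := m) (m := m + 1) (n := m + 2) (p := m + 3)
      (by omega) (by omega) (by omega) (by omega) (by omega),
    tdet_diag_013 v (i := m - 3) (j := m - 2) (k := m - 1) (m := m) (n := m + 1) (p := m + 2)
      (by omega) (by omega) (by omega) (by omega) (by omega),
    tdet_diag_013 v (i := m - 2) (j := m - 1) (k := m) (m := m + 1) (n := m + 2) (p := m + 3)
      (by omega) (by omega) (by omega) (by omega) (by omega),
    h.one_add_yVertex_eq (i := m - 1) (a := m - 3) (b := m - 2) (q := m) (r := m + 1)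
      (by omega) (by omega) (by omega) (by omega),
    h.one_add_yVertex_eq (i := m + 1) (a := m - 1) (b := m) (q := m + 2) (r := m + 3)
      (by omega) (by omega) (by omega) (by omega),
    h.yVertex_eq (i := m + 1) (a := m - 1) (b := m) (q := m + 2) (r := m + 3)
      (by omega) (by omega) (by omega) (by omega),
    h.xEven_eq (i := m - 1) (a := m - 3) (b := m - 2) (q := m) (r := m + 1)
      (by omega) (by omega) (by omega) (by omega),
    h.yEdge_eq (i := m - 1) (a := m - 3) (b := m - 2) (q := m) (r := m + 1) (s := m + 2)
      (by omega) (by omega) (by omega) (by omega) (by omega)]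
  have d1 := h.ne_024 hB (i := m - 2) (k := m) (n := m + 2) (by omega) (by omega)
  have d2 := h.ne_024 hB (i := m - 1) (k := m + 1) (n := m + 3) (by omega) (by omega)
  have d3 := h.ne_023 (i := m - 3) (j := m - 1) (k := m) (by omega) (by omega)
  have d4 := h.ne_023 (i := m - 2) (j := m) (k := m + 1) (by omega) (by omega)
  have d5 := h.ne_013 (i := m - 3) (j := m - 2) (k := m) (by omega) (by omega)
  have d6 := h.ne_023 (i := m - 1) (j := m + 1) (k := m + 2) (by omega) (by omega)
  have d7 := h.ne_012 (i := m - 1) (j := m) (k := m + 1) (by omega) (by omega)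
  have d8 := h.ne_012 (i := m - 3) (j := m - 2) (k := m - 1) (by omega) (by omega)
  have d9 := h.ne_012 (i := m + 1) (j := m + 2) (k := m + 3) (by omega) (by omega)
  have d10 := h.ne_012 (i := m) (j := m + 1) (k := m + 2) (by omega) (by omega)
  field_simp

/-- The mirror image of `GenericLift.xEven_pentagram`, for the polygon traversed backwards. -/
theorem GenericLift.xOdd_pentagram (h : GenericLift A v) (hB : A.pentagram.IsGeneric) (m : ℤ) :
    A.pentagram.xOdd m = A.xOdd (m + 2) * A.yVertex m * A.yEdge (m + 1) *
      (1 + A.yVertex (m + 2)) / (1 + A.yVertex m) := by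
  have h' := h.pentagram hB
  -- the determinants of the vertices of `T(A)` are monomials in those of the vertices of `A`
  have e1 := tdet_corner_012 (diag v) (i := m - 2) (j := m - 1) (k := m) (m := m + 1)
    (by omega) (by omega) (by omega)
  have e2 := tdet_corner_023 (diag v) (i := m - 1) (j := m) (k := m + 1) (m := m + 2) (n := m + 3)
    (by omega) (by omega) (by omega) (by omega)
  have e3 := tdet_corner_013 (diag v) (i := m - 1) (j := m) (k := m + 1) (m := m + 2) (n := m + 3)
    (by omega) (by omega) (by omega) (by omega)
  have e4 := tdet_corner_013 (diag v) (i := m - 2) (j := m - 1) (k := m) (m := m + 1) (n := m + 2)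
    (by omega) (by omega) (by omega) (by omega)
  have n1 := h.tdet_diag_ne_zero hB (i := m - 2) (j := m - 1) (k := m) (by omega) (by omega)
  have n2 := h.tdet_diag_ne_zero hB (i := m - 1) (j := m) (k := m + 1) (by omega) (by omega)
  rw [h'.xOdd_eq rfl rfl rfl rfl, e1, e2, e3, e4,
    tdet_diag_013 v (i := m - 2) (j := m - 1) (k := m) (m := m + 1) (n := m + 2) (p := m + 3)
      (by omega) (by omega) (by omega) (by omega) (by omega),
    tdet_diag_012 v (i := m) (j := m + 1) (k := m + 2) (m := m + 3) (n := m + 4)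
      (by omega) (by omega) (by omega) (by omega),
    tdet_diag_023 v (i := m - 1) (j := m) (k := m + 1) (m := m + 2) (n := m + 3) (p := m + 4)
      (by omega) (by omega) (by omega) (by omega) (by omega),
    tdet_diag_023 v (i := m - 2) (j := m - 1) (k := m) (m := m + 1) (n := m + 2) (p := m + 3)
      (by omega) (by omega) (by omega) (by omega) (by omega),
    h.one_add_yVertex_eq (i := m + 2) (a := m) (b := m + 1) (q := m + 3) (r := m + 4)
      (by omega) (by omega) (by omega) (by omega),
    h.one_add_yVertex_eq (i := m) (a := m - 2) (b := m - 1) (q := m + 1) (r := m + 2)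
      (by omega) (by omega) (by omega) (by omega),
    h.yVertex_eq (i := m) (a := m - 2) (b := m - 1) (q := m + 1) (r := m + 2)
      (by omega) (by omega) (by omega) (by omega),
    h.xOdd_eq (i := m + 2) (a := m) (b := m + 1) (q := m + 3) (r := m + 4)
      (by omega) (by omega) (by omega) (by omega),
    h.yEdge_eq (i := m + 1) (a := m - 1) (b := m) (q := m + 2) (r := m + 3) (s := m + 4)
      (by omega) (by omega) (by omega) (by omega) (by omega)]
  have d1 := h.ne_024 hB (i := m - 2) (k := m) (n := m + 2) (by omega) (by omega)
  have d2 := h.ne_024 hB (i := m - 1) (k := m + 1) (n := m + 3) (by omega) (by omega)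
  have d3 := h.ne_013 (i := m + 1) (j := m + 2) (k := m + 4) (by omega) (by omega)
  have d4 := h.ne_013 (i := m) (j := m + 1) (k := m + 3) (by omega) (by omega)
  have d5 := h.ne_013 (i := m - 1) (j := m) (k := m + 2) (by omega) (by omega)
  have d6 := h.ne_023 (i := m + 1) (j := m + 3) (k := m + 4) (by omega) (by omega)
  have d7 := h.ne_012 (i := m - 1) (j := m) (k := m + 1) (by omega) (by omega)
  have d8 := h.ne_012 (i := m - 2) (j := m - 1) (k := m) (by omega) (by omega)
  have d9 := h.ne_012 (i := m + 2) (j := m + 3) (k := m + 4) (by omega) (by omega)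
  have d10 := h.ne_012 (i := m) (j := m + 1) (k := m + 2) (by omega) (by omega)
  field_simp

end Pentagram

/-! ### The pentagram map on the coordinates -/

namespace Polygon

variable {A : Polygon} {i j : ℤ}

theorem x_eq_xEven (h : j = A.shift + 2 * i) : A.x j = A.xEven i := by
  rw [x, if_pos ⟨i, by omega⟩, show (j - A.shift) / 2 = i by omega]

theorem x_eq_xOdd (h : j = A.shift + 2 * i + 1) : A.x j = A.xOdd i := by
  rw [x, if_neg (by rw [Int.not_even_iff_odd]; exact ⟨i, by omega⟩),
    show (j - 1 - A.shift) / 2 = i by omega]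

theorem y_eq_yVertex (h : j = A.shift + 2 * i) : A.y j = A.yVertex i := by
  rw [y, if_pos ⟨i, by omega⟩, show (j - A.shift) / 2 = i by omega]

theorem y_eq_yEdge (h : j = A.shift + 2 * i + 1) : A.y j = A.yEdge i := by
  rw [y, if_neg (by rw [Int.not_even_iff_odd]; exact ⟨i, by omega⟩),
    show (j - 1 - A.shift) / 2 = i by omega]

theorem IsGeneric.exists_lift (hA : A.IsGeneric) : ∃ v, GenericLift A v :=
  ⟨fun i => (A.pt i).rep, hA.genericLift fun _ => isRep_rep _⟩

theorem IsGeneric.y_ne_zero (hA : A.IsGeneric) (j : ℤ) : A.y j ≠ 0 := by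
  obtain ⟨v, h⟩ := hA.exists_lift
  rcases Int.even_or_odd' (j - A.shift) with ⟨i, hi | hi⟩
  · rw [y_eq_yVertex (i := i) (by omega), h.yVertex_eq_x]
    exact neg_ne_zero.2 (inv_ne_zero (mul_ne_zero (h.xEven_ne_zero _) (h.xOdd_ne_zero _)))
  · rw [y_eq_yEdge (i := i) (by omega), h.yEdge_eq_x]
    exact neg_ne_zero.2 (mul_ne_zero (h.xOdd_ne_zero _) (h.xEven_ne_zero _))

theorem IsGeneric.one_add_y_ne_zero (hA : A.IsGeneric) (hB : A.pentagram.IsGeneric)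
    (hj : Even (j - A.shift)) : 1 + A.y j ≠ 0 := by
  obtain ⟨v, h⟩ := hA.exists_lift
  obtain ⟨i, hi⟩ := hj
  rw [y_eq_yVertex (i := i) (by omega)]
  exact h.one_add_yVertex_ne_zero hB i

theorem IsGeneric.x_pentagram_of_odd (hA : A.IsGeneric) (hB : A.pentagram.IsGeneric)
    (hj : Odd (j - A.shift)) : A.pentagram.x j =
      A.x (j - 3) * A.y (j - 2) * A.y (j + 1) * (1 + A.y (j - 3)) / (1 + A.y (j + 1)) := by
  obtain ⟨v, h⟩ := hA.exists_lift
  obtain ⟨i, hi⟩ := hj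
  rw [x_eq_xEven (A := A.pentagram) (i := i) (by rw [pentagram]; dsimp only; omega),
    x_eq_xEven (j := j - 3) (i := i - 1) (by omega),
    y_eq_yVertex (j := j - 3) (i := i - 1) (by omega),
    y_eq_yEdge (j := j - 2) (i := i - 1) (by omega),
    y_eq_yVertex (j := j + 1) (i := i + 1) (by omega)]
  exact h.xEven_pentagram hB i

theorem IsGeneric.x_pentagram_of_even (hA : A.IsGeneric) (hB : A.pentagram.IsGeneric)
    (hj : Even (j - A.shift)) : A.pentagram.x j =
      A.x (j + 3) * A.y (j - 2) * A.y (j + 1) * (1 + A.y (j + 2)) / (1 + A.y (j - 2)) := by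
  obtain ⟨v, h⟩ := hA.exists_lift
  obtain ⟨i, hi⟩ := hj
  rw [x_eq_xOdd (A := A.pentagram) (i := i - 1) (by rw [pentagram]; dsimp only; omega),
    x_eq_xOdd (j := j + 3) (i := i - 1 + 2) (by omega),
    y_eq_yVertex (j := j + 2) (i := i - 1 + 2) (by omega),
    y_eq_yEdge (j := j + 1) (i := i - 1 + 1) (by omega),
    y_eq_yVertex (j := j - 2) (i := i - 1) (by omega)]
  exact h.xOdd_pentagram hB (i - 1)

theorem IsGeneric.y_eq_x_of_even (hA : A.IsGeneric) (hj : Even (j - A.shift)) :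
    A.y j = -(A.x j * A.x (j + 1))⁻¹ := by
  obtain ⟨v, h⟩ := hA.exists_lift
  obtain ⟨i, hi⟩ := hj
  rw [y_eq_yVertex (i := i) (by omega), x_eq_xEven (j := j) (i := i) (by omega),
    x_eq_xOdd (j := j + 1) (i := i) (by omega), h.yVertex_eq_x]

theorem IsGeneric.y_eq_x_of_odd (hA : A.IsGeneric) (hj : Odd (j - A.shift)) :
    A.y j = -(A.x j * A.x (j + 1)) := by
  obtain ⟨v, h⟩ := hA.exists_lift
  obtain ⟨i, hi⟩ := hj
  rw [y_eq_yEdge (i := i) (by omega), x_eq_xOdd (j := j) (i := i) (by omega),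
    x_eq_xEven (j := j + 1) (i := i + 1) (by omega), h.yEdge_eq_x]

theorem IsGeneric.x_ne_zero (hA : A.IsGeneric) (j : ℤ) : A.x j ≠ 0 := by
  obtain ⟨v, h⟩ := hA.exists_lift
  rcases Int.even_or_odd' (j - A.shift) with ⟨i, hi | hi⟩
  · rw [x_eq_xEven (i := i) (by omega)]
    exact h.xEven_ne_zero i
  · rw [x_eq_xOdd (i := i) (by omega)]
    exact h.xOdd_ne_zero i

theorem IsGeneric.y_pentagram_of_even (hA : A.IsGeneric) (hB : A.pentagram.IsGeneric)
    (hj : Even (j - A.shift)) : A.pentagram.y j = (A.y j)⁻¹ := by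
  have hs : A.pentagram.shift = A.shift + 1 := rfl
  have hj' := hj
  rw [Int.even_iff] at hj'
  rw [hB.y_eq_x_of_odd (by rw [Int.odd_iff]; omega), hA.x_pentagram_of_even hB hj,
    hA.x_pentagram_of_odd hB (j := j + 1) (by rw [Int.odd_iff]; omega)]
  have h1 := hA.one_add_y_ne_zero hB (j := j - 2) (by rw [Int.even_iff]; omega)
  have h2 := hA.one_add_y_ne_zero hB (j := j + 2) (by rw [Int.even_iff]; omega)
  rw [show j + 1 - 3 = j - 2 by ring, show j + 1 - 2 = j - 1 by ring,
    show j + 1 + 1 = j + 2 by ring, hA.y_eq_x_of_even hj]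
  have e1 := hA.y_eq_x_of_even (j := j - 2) (by rw [Int.even_iff]; omega)
  have e2 := hA.y_eq_x_of_even (j := j + 2) (by rw [Int.even_iff]; omega)
  have e3 := hA.y_eq_x_of_odd (j := j - 1) (by rw [Int.odd_iff]; omega)
  have e4 := hA.y_eq_x_of_odd (j := j + 1) (by rw [Int.odd_iff]; omega)
  rw [show j - 2 + 1 = j - 1 by ring] at e1
  rw [show j + 2 + 1 = j + 3 by ring] at e2
  rw [show j - 1 + 1 = j by ring] at e3
  rw [show j + 1 + 1 = j + 2 by ring] at e4
  have n1 := hA.x_ne_zero (j - 2)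
  have n2 := hA.x_ne_zero (j - 1)
  have n3 := hA.x_ne_zero j
  have n4 := hA.x_ne_zero (j + 1)
  have n5 := hA.x_ne_zero (j + 2)
  have n6 := hA.x_ne_zero (j + 3)
  calc _ = -(A.x (j + 3) * A.x (j - 2) * A.y (j - 2) * A.y (j + 2) * A.y (j - 1) *
        A.y (j + 1)) := by field_simp
    _ = _ := by rw [e1, e2, e3, e4]; field_simp

theorem IsGeneric.y_pentagram_of_odd (hA : A.IsGeneric) (hB : A.pentagram.IsGeneric)
    (hj : Odd (j - A.shift)) : A.pentagram.y j =
      A.y j * ((1 + A.y (j + 1)) * (1 + A.y (j - 1))) * (A.y (j + 3) * A.y (j - 3)) /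
        ((1 + A.y (j + 3)) * (1 + A.y (j - 3))) := by
  have hs : A.pentagram.shift = A.shift + 1 := rfl
  have hj' := hj
  rw [Int.odd_iff] at hj'
  rw [hB.y_eq_x_of_even (by rw [Int.even_iff]; omega), hA.x_pentagram_of_odd hB hj,
    hA.x_pentagram_of_even hB (j := j + 1) (by rw [Int.even_iff]; omega)]
  have h1 := hA.one_add_y_ne_zero hB (j := j - 1) (by rw [Int.even_iff]; omega)
  have h2 := hA.one_add_y_ne_zero hB (j := j + 1) (by rw [Int.even_iff]; omega)
  have h3 := hA.one_add_y_ne_zero hB (j := j - 3) (by rw [Int.even_iff]; omega)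
  have h4 := hA.one_add_y_ne_zero hB (j := j + 3) (by rw [Int.even_iff]; omega)
  rw [show j + 1 + 3 = j + 4 by ring, show j + 1 - 2 = j - 1 by ring,
    show j + 1 + 1 = j + 2 by ring, show j + 1 + 2 = j + 3 by ring]
  have e0 := hA.y_eq_x_of_odd hj
  have e1 := hA.y_eq_x_of_even (j := j - 3) (by rw [Int.even_iff]; omega)
  have e2 := hA.y_eq_x_of_even (j := j + 3) (by rw [Int.even_iff]; omega)
  have e3 := hA.y_eq_x_of_odd (j := j - 2) (by rw [Int.odd_iff]; omega)
  have e4 := hA.y_eq_x_of_odd (j := j + 2) (by rw [Int.odd_iff]; omega)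
  have e5 := hA.y_eq_x_of_even (j := j - 1) (by rw [Int.even_iff]; omega)
  have e6 := hA.y_eq_x_of_even (j := j + 1) (by rw [Int.even_iff]; omega)
  rw [show j - 3 + 1 = j - 2 by ring] at e1
  rw [show j + 3 + 1 = j + 4 by ring] at e2
  rw [show j - 2 + 1 = j - 1 by ring] at e3
  rw [show j + 2 + 1 = j + 3 by ring] at e4
  rw [show j - 1 + 1 = j by ring] at e5
  rw [show j + 1 + 1 = j + 2 by ring] at e6
  have n0 := hA.x_ne_zero (j - 3)
  have n1 := hA.x_ne_zero (j - 2)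
  have n2 := hA.x_ne_zero (j - 1)
  have n3 := hA.x_ne_zero j
  have n4 := hA.x_ne_zero (j + 1)
  have n5 := hA.x_ne_zero (j + 2)
  have n6 := hA.x_ne_zero (j + 3)
  have n7 := hA.x_ne_zero (j + 4)
  have key : A.y j * (A.y (j + 3) * A.y (j - 3)) * (A.x (j - 3) * A.y (j - 2) * A.y (j + 1) *
      (A.x (j + 4) * A.y (j - 1) * A.y (j + 2))) = -1 := by
    rw [e0, e1, e2, e3, e4, e5, e6]; field_simp
  have m1 := hA.y_ne_zero (j - 2)
  have m2 := hA.y_ne_zero (j + 1)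
  have m3 := hA.y_ne_zero (j - 1)
  have m4 := hA.y_ne_zero (j + 2)
  field_simp
  linear_combination -key

end Polygon

/-! ### The evaluated `F`-polynomials under the pentagram map -/

theorem F_of_nonpos {R : Type*} [CommSemiring R] (y : ℤ → R) (j : ℤ) {k : ℤ} (hk : k ≤ 0) :
    F y j k = 1 := by
  have hP : posetP k = ∅ := by
    rw [posetP_eq_union, Finset.eq_empty_iff_forall_notMem]
    rintro ⟨r, s, t⟩ h
    simp only [Finset.mem_union, mem_layer_iff] at h
    omega
  have hJ : orderIdeals k = {∅} := by
    ext I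
    simp only [orderIdeals, hP, Finset.powerset_empty, Finset.mem_filter, Finset.mem_singleton]
    refine and_iff_left_of_imp ?_
    rintro rfl
    simp
  rw [F, hJ, Finset.sum_singleton, Finset.prod_empty]

/-- The evaluated `F`-polynomial `F_{j,k}` of `A` is an explicit product times the evaluated
polynomial `F_{j,k-1}` of `T(A)`. -/
theorem Polygon.IsGeneric.F_eq_F_pentagram {A : Polygon} (hA : A.IsGeneric)
    (hB : A.pentagram.IsGeneric) {j c l : ℤ} {k : ℕ} (hj : Odd (j + k - A.shift))
    (hc : c = j - 3 * k + 3) (hl : l = k - 1) :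
    F A.y j k = (∏ m ∈ Finset.range k, (1 + A.y (c + 6 * m))) * F A.pentagram.y j l := by
  rw [Int.odd_iff] at hj
  subst hc hl
  obtain _ | k := k
  · rw [F_of_nonpos _ _ (by simp), F_of_nonpos _ _ (by simp)]
    simp
  push_cast at hj ⊢
  have := sum_orderIdeals_succ_eq_mutate k (fun r s => A.y (3 * r + s + j))
    (fun r s => A.pentagram.y (3 * r + s + j)) (fun _ _ _ => hA.y_ne_zero _)
    (fun r s h => hA.one_add_y_ne_zero hB (by rw [Int.even_iff] at h ⊢; omega))
    (fun r s h => hA.y_pentagram_of_even hB (by rw [Int.even_iff] at h ⊢; omega))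
    (fun r s h => by
      rw [hA.y_pentagram_of_odd hB (by rw [Int.odd_iff] at h ⊢; omega),
        show 3 * r + (s + 1) + j = 3 * r + s + j + 1 by ring,
        show 3 * r + (s - 1) + j = 3 * r + s + j - 1 by ring,
        show 3 * (r + 1) + s + j = 3 * r + s + j + 3 by ring,
        show 3 * (r - 1) + s + j = 3 * r + s + j - 3 by ring])
  rw [add_sub_cancel_right]
  refine this.trans (congrArg₂ (· * ·) (Finset.prod_congr rfl fun m _ => ?_) rfl)
  congr 2
  ring

section Products

variable {R : Type*} [CommMonoid R]

/-- The factors are paired, since `y j` transforms according to the parity of `j`. -/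
theorem prod_Ico_neg_eq_prod_range (g : ℤ → R) {j a : ℤ} {k : ℕ} (ha : a = j + 1 - 3 * k) :
    ∏ i ∈ Finset.Ico (-(k : ℤ)) k, g (j + 1 + 3 * i) =
      ∏ n ∈ Finset.range k, (g (a + 6 * n) * g (a + 6 * n + 3)) := by
  have h1 : ∏ i ∈ Finset.Ico (-(k : ℤ)) k, g (j + 1 + 3 * i) =
      ∏ m ∈ Finset.range (2 * k), g (a + 3 * m) := by
    symm
    refine Finset.prod_bij (fun m _ => (m : ℤ) - k) ?_ ?_ ?_ ?_
    · intro m hm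
      rw [Finset.mem_range] at hm
      rw [Finset.mem_Ico]
      omega
    · intro m _ m' _ h
      omega
    · intro i hi
      rw [Finset.mem_Ico] at hi
      exact ⟨(i + k).toNat, by rw [Finset.mem_range]; omega, by omega⟩
    · intro m _
      congr 1
      rw [ha]
      ring
  have h2 : ∀ (f : ℕ → R) (n : ℕ), ∏ m ∈ Finset.range (2 * n), f m =
      ∏ m ∈ Finset.range n, (f (2 * m) * f (2 * m + 1)) := by
    intro f n
    induction n with
    | zero => simp
    | succ n ih =>
      rw [Nat.mul_succ, Finset.prod_range_succ, Finset.prod_range_succ, Finset.prod_range_succ, ih,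
        mul_assoc]
  rw [h1, h2]
  refine Finset.prod_congr rfl fun n _ => ?_
  push_cast
  congr 2 <;> ring

theorem prod_range_succ_add_mul (g : ℤ → R) {c d : ℤ} (hd : d = c + 6) (k : ℕ) :
    ∏ n ∈ Finset.range (k + 1), g (c + 6 * n) =
      (∏ n ∈ Finset.range k, g (d + 6 * n)) * g c := by
  rw [Finset.prod_range_succ']
  refine congrArg₂ (· * ·) (Finset.prod_congr rfl fun n _ => ?_) (by simp)
  congr 1
  push_cast
  rw [hd]
  ring

end Products

namespace Polygon

variable {A : Polygon}

theorem IsGeneric.prod_y_pentagram_of_even (hA : A.IsGeneric) (hB : A.pentagram.IsGeneric)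
    {a : ℤ} (ha : Even (a - A.shift)) (k : ℕ) :
    ∏ n ∈ Finset.range k, (A.pentagram.y (a + 6 * n) * A.pentagram.y (a + 6 * n + 3)) =
      (∏ n ∈ Finset.range k, (A.y (a + 3 + 6 * n) * A.y (a + 3 + 6 * n + 3))) *
        ((∏ n ∈ Finset.range k, (1 + A.y (a + 2 + 6 * n))) *
          ∏ n ∈ Finset.range k, (1 + A.y (a + 4 + 6 * n))) /
        ((∏ n ∈ Finset.range k, (1 + A.y (a + 6 * n))) *
          ∏ n ∈ Finset.range k, (1 + A.y (a + 6 + 6 * n))) := by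
  rw [Int.even_iff] at ha
  rw [← Finset.prod_mul_distrib, ← Finset.prod_mul_distrib, ← Finset.prod_mul_distrib,
    ← Finset.prod_div_distrib]
  refine Finset.prod_congr rfl fun n _ => ?_
  rw [hA.y_pentagram_of_even hB (by rw [Int.even_iff]; omega),
    hA.y_pentagram_of_odd hB (by rw [Int.odd_iff]; omega),
    show a + 6 * (n : ℤ) + 3 + 3 = a + 6 + 6 * n by ring,
    show a + 6 * (n : ℤ) + 3 - 3 = a + 6 * n by ring,
    show a + 6 * (n : ℤ) + 3 + 1 = a + 4 + 6 * n by ring,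
    show a + 6 * (n : ℤ) + 3 - 1 = a + 2 + 6 * n by ring,
    show a + 6 * (n : ℤ) + 3 = a + 3 + 6 * n by ring,
    show a + 3 + 6 * (n : ℤ) + 3 = a + 6 + 6 * n by ring]
  have h0 := hA.y_ne_zero (a + 6 * n)
  generalize A.y (a + 6 * n) = u at *
  field_simp

theorem IsGeneric.prod_y_pentagram_of_odd (hA : A.IsGeneric) (hB : A.pentagram.IsGeneric)
    {a : ℤ} (ha : Odd (a - A.shift)) (k : ℕ) :
    ∏ n ∈ Finset.range k, (A.pentagram.y (a + 6 * n) * A.pentagram.y (a + 6 * n + 3)) =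
      (∏ n ∈ Finset.range k, (A.y (a - 3 + 6 * n) * A.y (a - 3 + 6 * n + 3))) *
        ((∏ n ∈ Finset.range k, (1 + A.y (a - 1 + 6 * n))) *
          ∏ n ∈ Finset.range k, (1 + A.y (a + 1 + 6 * n))) /
        ((∏ n ∈ Finset.range k, (1 + A.y (a - 3 + 6 * n))) *
          ∏ n ∈ Finset.range k, (1 + A.y (a + 3 + 6 * n))) := by
  rw [Int.odd_iff] at ha
  rw [← Finset.prod_mul_distrib, ← Finset.prod_mul_distrib, ← Finset.prod_mul_distrib,
    ← Finset.prod_div_distrib]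
  refine Finset.prod_congr rfl fun n _ => ?_
  rw [hA.y_pentagram_of_odd hB (by rw [Int.odd_iff]; omega),
    hA.y_pentagram_of_even hB (by rw [Int.even_iff]; omega),
    show a + 6 * (n : ℤ) + 3 = a + 3 + 6 * n by ring,
    show a + 6 * (n : ℤ) - 3 = a - 3 + 6 * n by ring,
    show a + 6 * (n : ℤ) + 1 = a + 1 + 6 * n by ring,
    show a + 6 * (n : ℤ) - 1 = a - 1 + 6 * n by ring,
    show a - 3 + 6 * (n : ℤ) + 3 = a + 6 * n by ring]
  have h0 := hA.y_ne_zero (a + 3 + 6 * n)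
  generalize A.y (a + 3 + 6 * n) = u at *
  field_simp

end Polygon

/-! ### Induction on the number of iterations -/

/-- The formula for an arbitrary index set `shift / 2 + ℤ`, as the induction passes from `A` to
`T(A)`. The products over `i` are grouped in steps of `6`, starting at `a = j + 1 - 3 k`. -/
theorem pentagram_iterate_x_of_even (k : ℕ) (A : Polygon)
    (hgen : ∀ i : ℕ, i ≤ k → (Polygon.pentagram^[i] A).IsGeneric) (j : ℤ)
    (hj : Even (j + k - A.shift)) :
    F A.y (j - 2) (k - 1) ≠ 0 ∧ F A.y (j + 1) k ≠ 0 ∧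
      (Polygon.pentagram^[k] A).x j =
        A.x (j - 3 * k) * (∏ i ∈ Finset.Ico (-(k : ℤ)) k, A.y (j + 1 + 3 * i)) *
          ((F A.y (j + 2) (k - 1) * F A.y (j - 3) k) /
            (F A.y (j - 2) (k - 1) * F A.y (j + 1) k)) := by
  induction k generalizing A with
  | zero => simp [F_of_nonpos]
  | succ k ih =>
    have hA : A.IsGeneric := hgen 0 (by omega)
    have hB : A.pentagram.IsGeneric := hgen 1 (by omega)
    have hs : A.pentagram.shift = A.shift + 1 := rfl
    rw [Int.even_iff] at hj
    push_cast at hj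
    obtain ⟨ih1, ih2, ih3⟩ := ih A.pentagram
      (fun i hi => by simpa using hgen (i + 1) (by omega)) (by rw [Int.even_iff]; omega)
    obtain ⟨a, ha⟩ : ∃ a : ℤ, a = j + 1 - 3 * k := ⟨_, rfl⟩
    have f1 := hA.F_eq_F_pentagram hB (j := j - 2) (k := k) (c := a)
      (by rw [Int.odd_iff]; omega) (by omega) rfl
    have f2 := hA.F_eq_F_pentagram hB (j := j + 2) (k := k) (c := a + 4)
      (by rw [Int.odd_iff]; omega) (by omega) rfl
    have f3 := hA.F_eq_F_pentagram hB (j := j + 1) (k := k + 1) (c := a) (l := k)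
      (by rw [Int.odd_iff]; omega) (by omega) (by omega)
    have f4 := hA.F_eq_F_pentagram hB (j := j - 3) (k := k + 1) (c := a - 4) (l := k)
      (by rw [Int.odd_iff]; omega) (by omega) (by omega)
    rw [prod_range_succ_add_mul (fun c => 1 + A.y c) rfl] at f3
    rw [prod_range_succ_add_mul (fun c => 1 + A.y c) (d := a + 2) (by ring)] at f4
    have hne : ∀ c : ℤ, (c - a) % 2 = 0 →
        ∏ n ∈ Finset.range k, (1 + A.y (c + 6 * n)) ≠ 0 := fun c hc =>
      Finset.prod_ne_zero_iff.2 fun n _ => hA.one_add_y_ne_zero hB (by rw [Int.even_iff]; omega)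
    have n1 := hne a (by omega)
    have n2 := hne (a + 2) (by omega)
    have n3 := hne (a + 4) (by omega)
    have n4 := hne (a + 6) (by omega)
    have n5 : 1 + A.y a ≠ 0 := hA.one_add_y_ne_zero hB (by rw [Int.even_iff]; omega)
    have hx := hA.x_pentagram_of_odd hB (j := j - 3 * k) (by rw [Int.odd_iff]; omega)
    rw [show j - 3 * (k : ℤ) - 3 = a - 4 by omega, show j - 3 * (k : ℤ) - 2 = a - 3 by omega,
      show j - 3 * (k : ℤ) + 1 = a by omega] at hx
    have hy := hA.prod_y_pentagram_of_even hB (a := a) (by rw [Int.even_iff]; omega) k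
    rw [← prod_Ico_neg_eq_prod_range _ ha] at hy
    have hy' := prod_Ico_neg_eq_prod_range A.y (j := j) (k := k + 1) (a := a - 3) (by omega)
    rw [prod_range_succ_add_mul (fun c => A.y c * A.y (c + 3)) (d := a + 3) (by ring),
      sub_add_cancel] at hy'
    rw [show ((k + 1 : ℕ) : ℤ) - 1 = k by omega,
      show j - 3 * ((k + 1 : ℕ) : ℤ) = a - 4 by omega, f1, f2, f3, f4, hy',
      Function.iterate_succ_apply, ih3, hx, hy]
    refine ⟨mul_ne_zero n1 ih1, mul_ne_zero (mul_ne_zero n4 n5) ih2, ?_⟩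
    field_simp

/-- The counterpart of `pentagram_iterate_x_of_even` for the other parity. -/
theorem pentagram_iterate_x_of_odd (k : ℕ) (A : Polygon)
    (hgen : ∀ i : ℕ, i ≤ k → (Polygon.pentagram^[i] A).IsGeneric) (j : ℤ)
    (hj : Odd (j + k - A.shift)) :
    F A.y (j + 1) (k - 1) ≠ 0 ∧ F A.y (j - 2) k ≠ 0 ∧
      (Polygon.pentagram^[k] A).x j =
        A.x (j + 3 * k) * (∏ i ∈ Finset.Ico (-(k : ℤ)) k, A.y (j + 1 + 3 * i)) *
          ((F A.y (j - 3) (k - 1) * F A.y (j + 2) k) /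
            (F A.y (j + 1) (k - 1) * F A.y (j - 2) k)) := by
  induction k generalizing A with
  | zero => simp [F_of_nonpos]
  | succ k ih =>
    have hA : A.IsGeneric := hgen 0 (by omega)
    have hB : A.pentagram.IsGeneric := hgen 1 (by omega)
    have hs : A.pentagram.shift = A.shift + 1 := rfl
    rw [Int.odd_iff] at hj
    push_cast at hj
    obtain ⟨ih1, ih2, ih3⟩ := ih A.pentagram
      (fun i hi => by simpa using hgen (i + 1) (by omega)) (by rw [Int.odd_iff]; omega)
    obtain ⟨a, ha⟩ : ∃ a : ℤ, a = j + 1 - 3 * k := ⟨_, rfl⟩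
    have f1 := hA.F_eq_F_pentagram hB (j := j + 1) (k := k) (c := a + 3)
      (by rw [Int.odd_iff]; omega) (by omega) rfl
    have f2 := hA.F_eq_F_pentagram hB (j := j - 3) (k := k) (c := a - 1)
      (by rw [Int.odd_iff]; omega) (by omega) rfl
    have f3 := hA.F_eq_F_pentagram hB (j := j - 2) (k := k + 1) (c := a - 3) (l := k)
      (by rw [Int.odd_iff]; omega) (by omega) (by omega)
    have f4 := hA.F_eq_F_pentagram hB (j := j + 2) (k := k + 1) (c := a + 1) (l := k)
      (by rw [Int.odd_iff]; omega) (by omega) (by omega)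
    rw [Finset.prod_range_succ, show a - 3 + 6 * (k : ℤ) = j + 3 * k - 2 by omega] at f3
    rw [Finset.prod_range_succ, show a + 1 + 6 * (k : ℤ) = j + 3 * k + 2 by omega] at f4
    have hne : ∀ c : ℤ, (c - a) % 2 = 1 →
        ∏ n ∈ Finset.range k, (1 + A.y (c + 6 * n)) ≠ 0 := fun c hc =>
      Finset.prod_ne_zero_iff.2 fun n _ => hA.one_add_y_ne_zero hB (by rw [Int.even_iff]; omega)
    have n1 := hne (a - 3) (by omega)
    have n2 := hne (a - 1) (by omega)
    have n3 := hne (a + 1) (by omega)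
    have n4 := hne (a + 3) (by omega)
    have n5 : 1 + A.y (j + 3 * k - 2) ≠ 0 :=
      hA.one_add_y_ne_zero hB (by rw [Int.even_iff]; omega)
    have hx := hA.x_pentagram_of_even hB (j := j + 3 * k) (by rw [Int.even_iff]; omega)
    have hy := hA.prod_y_pentagram_of_odd hB (a := a) (by rw [Int.odd_iff]; omega) k
    rw [← prod_Ico_neg_eq_prod_range _ ha] at hy
    have hy' := prod_Ico_neg_eq_prod_range A.y (j := j) (k := k + 1) (a := a - 3) (by omega)
    rw [Finset.prod_range_succ, show a - 3 + 6 * (k : ℤ) = j + 3 * k - 2 by omega,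
      show j + 3 * (k : ℤ) - 2 + 3 = j + 3 * k + 1 by ring] at hy'
    rw [show ((k + 1 : ℕ) : ℤ) - 1 = k by omega,
      show j + 3 * ((k + 1 : ℕ) : ℤ) = j + 3 * k + 3 by omega, f1, f2, f3, f4, hy',
      Function.iterate_succ_apply, ih3, hx, hy]
    refine ⟨mul_ne_zero n4 ih1, mul_ne_zero (mul_ne_zero n1 n5) ih2, ?_⟩
    field_simp

end PentagramMap

open PentagramMap in
theorem mainTheorem3 (n : ℕ) (hn : 1 ≤ n) (A : Polygon) (hshift : A.shift = 0)
    (hA : A.IsTwisted n) (k : ℕ)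
    (hgen : ∀ i : ℕ, i ≤ k → (Polygon.pentagram^[i] A).IsGeneric) (j : ℤ) :
    (Even (j + k) →
      F A.y (j - 2) (k - 1) ≠ 0 ∧ F A.y (j + 1) k ≠ 0 ∧
      (Polygon.pentagram^[k] A).x j =
        A.x (j - 3 * k) * (∏ i ∈ Finset.Ico (-(k : ℤ)) k, A.y (j + 1 + 3 * i)) *
          ((F A.y (j + 2) (k - 1) * F A.y (j - 3) k) /
            (F A.y (j - 2) (k - 1) * F A.y (j + 1) k))) ∧
    (Odd (j + k) →
      F A.y (j + 1) (k - 1) ≠ 0 ∧ F A.y (j - 2) k ≠ 0 ∧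
      (Polygon.pentagram^[k] A).x j =
        A.x (j + 3 * k) * (∏ i ∈ Finset.Ico (-(k : ℤ)) k, A.y (j + 1 + 3 * i)) *
          ((F A.y (j - 3) (k - 1) * F A.y (j + 2) k) /
            (F A.y (j + 1) (k - 1) * F A.y (j - 2) k))) :=
  ⟨fun h => pentagram_iterate_x_of_even k A hgen j (by rwa [hshift, sub_zero]),
    fun h => pentagram_iterate_x_of_odd k A hgen j (by rwa [hshift, sub_zero])⟩
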